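/- Let $d\ge1$, $A>0$, and assume either $d\ge2$ and $\gamma=1+\frac1{d-1}$, or $\gamma=\gamma_d:=1+\frac2d$ (the mono-atomic exponent). Set $\kappa=\frac{\gamma-1}2$ and let $s>1+\frac d2$. Let $c_0:\mathbb R^d\to[0,\infty)$ and $u_0:\mathbb R^d\to\mathbb R^d$ belong to the Sobolev space $H^s(\mathbb R^d)$ (and be identified with their continuous representatives, which are $C^1$). Assume that $\Omega(0)=\{x : c_0(x)>0\}$ is non-empty and bounded, with smooth boundary. Let $\rho_0\ge0$ be the density defined by $c_0=\sqrt{\gamma A}\,\rho_0^{\kappa}$ (pressure law $p(\rho)=A\rho^\gamma$), and put $$M=\int_{\mathbb R^d}\rho_0\,dx,\qquad I=\int_{\Omega(0)}\tfrac12\rho_0|x|^2\,dx,\qquad J=\int_{\Omega(0)}\det\nabla u_0\,dx .$$ Consider the isentropic Euler system in its symmetric form, with $\bar c=c/\kappa$, $$\partial_t\bar c+(u\cdot\nabla)\bar c+\kappa\,\bar c\,\mathrm{div}\,u=0,\qquad \partial_tu+(u\cdot\nabla)u+\kappa\,\bar c\,\nabla\bar c=0,\qquad (c,u)|_{t=0}=(c_0,u_0),$$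 and let $T^*\in[0,\infty]$ be the supremum of the $b>0$ such that, for some $a<0$, there is a solution $(c,u)$ on $(a,b)\times\mathbb R^d$ in the class $\mathcal C((a,b);H^s)\cap\mathcal C^1((a,b);H^{s-1})$ (the maximal time of existence). If $$J<\left(\frac{2AM^\gamma}{(\gamma-1)I}\right)^{d/2},$$ then $T^*<+\infty$: the smooth solution blows up in finite time. -/

import Mathlib

open MeasureTheory Set TemperedDistribution
open scoped ContDiff ENNReal

noncomputable section

namespace GasVacuum

/-- The physical space `ℝ^d`. -/
abbrev Sp (d : ℕ) : Type := EuclideanSpace ℝ (Fin d)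

/-- The Hilbert space `L²(ℝ^d; ℂ)`. -/
abbrev L2 (d : ℕ) : Type := Lp ℂ 2 (volume : Measure (Sp d))

/-- `HasBessel r f g` says that the real function `f` is in `L²` and that its Bessel potential
`(1 + |ξ|²)^{r/2}` (as a Fourier multiplier, applied to `f` as a tempered distribution) is the
`L²` function `g`. Hence `f ∈ H^r` with `‖f‖_{H^r} = ‖g‖_{L²}`. It is only used with `r ≥ 0`, where
`H^r ⊆ L²`. -/
def HasBessel {d : ℕ} (r : ℝ) (f : Sp d → ℝ) (g : L2 d) : Prop :=
  ∃ hf : MemLp (fun x => (f x : ℂ)) 2 (volume : Measure (Sp d)),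
    besselPotential (Sp d) ℂ r (Lp.toTemperedDistribution (hf.toLp (fun x => (f x : ℂ))))
      = Lp.toTemperedDistribution g

/-- `f ∈ H^r(ℝ^d)`, for a real function. -/
def MemH {d : ℕ} (r : ℝ) (f : Sp d → ℝ) : Prop := ∃ g : L2 d, HasBessel r f g

/-- `f ∈ 𝒞(I; H^r)`: the Bessel potential of order `r`, which is an isometry from `H^r` onto `L²`,
turns `f` into a continuous curve in `L²`. -/
def ContInH {d : ℕ} (r : ℝ) (I : Set ℝ) (f : ℝ → Sp d → ℝ) : Prop :=
  ∃ G : ℝ → L2 d, ContinuousOn G I ∧ ∀ t ∈ I, HasBessel r (f t) (G t)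

/-- `f ∈ 𝒞¹(I; H^r)` with derivative `f'`, for an open set `I` of times. -/
def C1InH {d : ℕ} (r : ℝ) (I : Set ℝ) (f f' : ℝ → Sp d → ℝ) : Prop :=
  ∃ G G' : ℝ → L2 d, ContinuousOn G' I ∧ ∀ t ∈ I,
    HasDerivAt G (G' t) t ∧ HasBessel r (f t) (G t) ∧ HasBessel r (f' t) (G' t)

/-- The exponent `κ = (γ - 1) / 2`. -/
def kappa (γ : ℝ) : ℝ := (γ - 1) / 2

/-- The divergence of a vector field. -/
def divergence {d : ℕ} (v : Sp d → Sp d) (x : Sp d) : ℝ :=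
  LinearMap.trace ℝ (Sp d) (fderiv ℝ v x : Sp d →ₗ[ℝ] Sp d)

/-- `(c, u)` is a solution on the open time interval `I` of the Euler system in the symmetric form
`∂ₜ c̄ + (u·∇) c̄ + κ c̄ div u = 0`, `∂ₜ u + (u·∇) u + κ c̄ ∇ c̄ = 0`, where `c̄ = c / κ`, in the
class `𝒞(I; H^s) ∩ 𝒞¹(I; H^{s-1})`, with the data `(c₀, u₀)` at `t = 0`. The time derivatives `ct`
and `ut` are those of the curves in `H^{s-1}`. Elements of `H^s` are represented by their continuous
representatives, which are of class `C¹` when `s > 1 + d / 2`. -/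
def IsSolution {d : ℕ} (γ s : ℝ) (c₀ : Sp d → ℝ) (u₀ : Sp d → Sp d) (I : Set ℝ)
    (c : ℝ → Sp d → ℝ) (u : ℝ → Sp d → Sp d) : Prop :=
  c 0 = c₀ ∧ u 0 = u₀ ∧
  (∀ t ∈ I, Continuous (c t) ∧ Continuous (u t)) ∧
  ContInH s I c ∧ (∀ i, ContInH s I (fun t x => u t x i)) ∧
  ∃ (ct : ℝ → Sp d → ℝ) (ut : ℝ → Sp d → Sp d),
    C1InH (s - 1) I c ct ∧ (∀ i, C1InH (s - 1) I (fun t x => u t x i) (fun t x => ut t x i)) ∧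
    ∀ t ∈ I, ∀ᵐ x : Sp d,
      ct t x / kappa γ + fderiv ℝ (fun y => c t y / kappa γ) x (u t x)
          + kappa γ * (c t x / kappa γ) * divergence (u t) x = 0 ∧
      ut t x + fderiv ℝ (u t) x (u t x)
          + (kappa γ * (c t x / kappa γ)) • gradient (fun y => c t y / kappa γ) x = 0

/-- The maximal time of existence `T^* ∈ [0, ∞]`: the supremum of the `b > 0` such that there is
a solution on some open interval `(a, b)` containing `0`. -/
def maximalTime {d : ℕ} (γ s : ℝ) (c₀ : Sp d → ℝ) (u₀ : Sp d → Sp d) : ℝ≥0∞ :=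
  sSup {T | ∃ a b : ℝ, a < 0 ∧ 0 < b ∧ T = ENNReal.ofReal b ∧
    ∃ (c : ℝ → Sp d → ℝ) (u : ℝ → Sp d → Sp d), IsSolution γ s c₀ u₀ (Ioo a b) c u}

/-- The open set `Ω` has a smooth boundary: near each boundary point it is the sublevel set
`{φ < 0}` of a smooth function whose differential does not vanish at that point. -/
def HasSmoothBoundary {d : ℕ} (Ω : Set (Sp d)) : Prop :=
  ∀ p ∈ frontier Ω, ∃ (U : Set (Sp d)) (φ : Sp d → ℝ), IsOpen U ∧ p ∈ U ∧
    ContDiffOn ℝ ∞ φ U ∧ fderiv ℝ φ p ≠ 0 ∧ ∀ x ∈ U, x ∈ Ω ↔ φ x < 0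

/-- The region `{c > 0}` occupied by a gas with sound speed `c`. -/
def region {d : ℕ} (c : Sp d → ℝ) : Set (Sp d) := {x | 0 < c x}

/-- The density of a gas with sound speed `c`: the solution `ρ ≥ 0` of `c = √(γ A) ρ ^ κ`. -/
def density {d : ℕ} (A γ : ℝ) (c : Sp d → ℝ) (x : Sp d) : ℝ :=
  (c x / √(γ * A)) ^ (1 / kappa γ)

/-- The total mass `M = ∫ ρ₀ dx`. -/
def totalMass {d : ℕ} (A γ : ℝ) (c₀ : Sp d → ℝ) : ℝ := ∫ x, density A γ c₀ x

/-- The moment `I = ∫_{Ω(0)} ½ ρ₀ |x|² dx`. -/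
def inertia {d : ℕ} (A γ : ℝ) (c₀ : Sp d → ℝ) : ℝ :=
  ∫ x in region c₀, (1 / 2) * density A γ c₀ x * ‖x‖ ^ 2

/-- The integral `J = ∫_{Ω(0)} det ∇u₀ dx`. -/
def jacobianIntegral {d : ℕ} (c₀ : Sp d → ℝ) (u₀ : Sp d → Sp d) : ℝ :=
  ∫ x in region c₀, (fderiv ℝ u₀ x).det

end GasVacuum

end

noncomputable section

namespace GasVacuum

open Filter Topology FourierTransform

variable {d : ℕ}

/-! ### The Sobolev embedding for Bessel potential spaces -/

/-! For both exponents, `1 / κ` is an integer `n`, so up to a constant factor the density is the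
polynomial `c ^ n`. The argument sets a virial identity against a support that can be made to spread
arbitrarily slowly.

A point of vacuum moves on a straight line: where `c = 0` the velocity equation has no pressure
term, so `u` is carried along unchanged and `c` stays zero (`eq_along_line`, by Grönwall). By
Riemann–Lebesgue, `u₀` tends to zero at infinity. Hence for every `ε > 0` there is an `R` such that
outside the ball of radius `R` there is vacuum with speed at most `ε`. At time `t` the same holds
outside radius `R + ε t` (`quietOutside`): every exterior point is reached by such a line.

While the solution exists, the mass `M` and the energy `E > 0` are conserved, and `F = ∫ ρ x · u`
satisfies `F' = ∫ (ρ |u|² + d p) ≥ E / n`. On the other hand `F ≤ (R + ε t) (M / 2 + E)`, since `|u|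
≤ (1 + |u|²) / 2`. Choosing `ε` so small that the right side grows at half the rate of the left
contradicts existence for large `t` (`virial_bound`, `maximalTime_lt_top`).

The analytic input is the Sobolev embedding by Fourier inversion: it makes a solution of the class
classical and `C¹` in `(t, x)`, with gradients bounded on compact sets of times. -/

lemma HasBessel.sub {r : ℝ} {f₁ f₂ : Sp d → ℝ} {g₁ g₂ : L2 d} (h₁ : HasBessel r f₁ g₁)
    (h₂ : HasBessel r f₂ g₂) : HasBessel r (fun x => f₁ x - f₂ x) (g₁ - g₂) := by
  obtain ⟨m₁, e₁⟩ := h₁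
  obtain ⟨m₂, e₂⟩ := h₂
  have m : MemLp (fun x => ((f₁ x - f₂ x : ℝ) : ℂ)) 2 (volume : Measure (Sp d)) := by
    simpa using! m₁.sub m₂
  refine ⟨m, ?_⟩
  have : m.toLp _ = m₁.toLp _ - m₂.toLp _ := by
    rw [← MemLp.toLp_sub]
    congr 1
    ext x
    simp
  rw [this, ← Lp.toTemperedDistributionCLM_apply, ← Lp.toTemperedDistributionCLM_apply, map_sub,
    map_sub, map_sub, Lp.toTemperedDistributionCLM_apply, Lp.toTemperedDistributionCLM_apply,
    Lp.toTemperedDistributionCLM_apply, Lp.toTemperedDistributionCLM_apply, e₁, e₂]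

lemma HasBessel.const_mul {r : ℝ} {f : Sp d → ℝ} {g : L2 d} (h : HasBessel r f g) (a : ℝ) :
    HasBessel r (fun x => a * f x) (a • g) := by
  obtain ⟨m, e⟩ := h
  have m' : MemLp (fun x => ((a * f x : ℝ) : ℂ)) 2 (volume : Measure (Sp d)) := by
    simpa using! m.const_smul (a : ℂ)
  refine ⟨m', ?_⟩
  have : m'.toLp _ = (a : ℂ) • m.toLp _ := by
    rw [← MemLp.toLp_const_smul]
    congr 1
    ext x
    simp
  have hg : a • g = (a : ℂ) • g := (Complex.coe_smul a g).symm
  rw [this, hg, ← Lp.toTemperedDistributionCLM_apply, ← Lp.toTemperedDistributionCLM_apply,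
    map_smul, map_smul, map_smul, Lp.toTemperedDistributionCLM_apply,
    Lp.toTemperedDistributionCLM_apply, e]

lemma HasBessel.congr_ae {r : ℝ} {f f' : Sp d → ℝ} {g : L2 d} (h : HasBessel r f g)
    (hff' : f =ᵐ[volume] f') : HasBessel r f' g := by
  obtain ⟨m, e⟩ := h
  have hc : (fun x => (f x : ℂ)) =ᵐ[volume] fun x => (f' x : ℂ) := by
    filter_upwards [hff'] with x hx
    rw [hx]
  refine ⟨(memLp_congr_ae hc).1 m, ?_⟩
  rw [← e]
  congr 2
  exact (MemLp.toLp_eq_toLp_iff _ _).2 hc.symm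

/-- The symbol of the Bessel potential of order `-r`. -/
def besselSymbol (r : ℝ) (ξ : Sp d) : ℝ := (1 + ‖ξ‖ ^ 2) ^ (-r / 2)

lemma besselSymbol_pos (r : ℝ) (ξ : Sp d) : 0 < besselSymbol r ξ := by
  unfold besselSymbol
  positivity

lemma continuous_besselSymbol (r : ℝ) : Continuous (besselSymbol r : Sp d → ℝ) := by
  unfold besselSymbol
  exact Continuous.rpow_const (by fun_prop) fun ξ => Or.inl (by positivity)

lemma memLp_besselSymbol {r : ℝ} (hr : (d : ℝ) < 2 * r) :
    MemLp (besselSymbol r : Sp d → ℝ) 2 volume := by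
  rw [memLp_two_iff_integrable_sq (continuous_besselSymbol r).aestronglyMeasurable]
  have := integrable_rpow_neg_one_add_norm_sq (E := Sp d) (μ := volume) (r := 2 * r)
    (by simpa using hr)
  refine this.congr (Eventually.of_forall fun ξ => ?_)
  simp only [besselSymbol]
  rw [← Real.rpow_mul_natCast (by positivity)]
  congr 1
  push_cast
  ring

lemma norm_mul_besselSymbol_le (r : ℝ) (ξ : Sp d) :
    ‖ξ‖ * besselSymbol r ξ ≤ besselSymbol (r - 1) ξ := by
  have h : ‖ξ‖ ≤ (1 + ‖ξ‖ ^ 2) ^ (1 / 2 : ℝ) := by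
    rw [← Real.sqrt_eq_rpow]
    exact Real.le_sqrt_of_sq_le (by linarith)
  calc ‖ξ‖ * besselSymbol r ξ ≤ (1 + ‖ξ‖ ^ 2) ^ (1 / 2 : ℝ) * besselSymbol r ξ :=
        mul_le_mul_of_nonneg_right h (besselSymbol_pos r ξ).le
    _ = besselSymbol (r - 1) ξ := by
        unfold besselSymbol
        rw [← Real.rpow_add (by positivity)]
        congr 1
        ring

lemma integrable_mul_L2 {w : Sp d → ℝ} (hw : MemLp w 2 volume) (g : L2 d) :
    Integrable (fun ξ => (w ξ : ℂ) * g ξ) volume ∧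
      ∫ ξ, ‖(w ξ : ℂ) * g ξ‖ ≤ ‖hw.toLp w‖ * ‖g‖ := by
  have hwc : MemLp (fun ξ => (w ξ : ℂ)) 2 (volume : Measure (Sp d)) := hw.ofReal
  have hn : ‖hwc.toLp _‖ = ‖hw.toLp w‖ := by
    rw [Lp.norm_toLp, Lp.norm_toLp]
    congr 1
    exact eLpNorm_congr_norm_ae (Eventually.of_forall fun x => by simp)
  let v : Lp ℂ 1 (volume : Measure (Sp d)) := hwc.toLp _ • g
  have hv : (v : Sp d → ℂ) =ᵐ[volume] fun ξ => (w ξ : ℂ) * g ξ := by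
    filter_upwards [Lp.coeFn_lpSMul (r := 1) (hwc.toLp _) g, hwc.coeFn_toLp] with ξ h1 h2
    rw [h1]
    simp [h2]
  refine ⟨(L1.integrable_coeFn v).congr hv, ?_⟩
  calc ∫ ξ, ‖(w ξ : ℂ) * g ξ‖ = ∫ ξ, ‖v ξ‖ :=
        integral_congr_ae (by filter_upwards [hv] with ξ h; rw [h])
    _ = ‖v‖ := (L1.norm_eq_integral_norm v).symm
    _ ≤ ‖hwc.toLp _‖ * ‖g‖ := Lp.norm_smul_le _ _
    _ = _ := by rw [hn]

/-- The Fourier transform of the function of `H^r` with Bessel potential `g`. -/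
def frequency (r : ℝ) (g : L2 d) (ξ : Sp d) : ℂ := (besselSymbol r ξ : ℂ) * (𝓕 g : L2 d) ξ

/-- Cauchy–Schwarz: the symbol is in `L²` because `2 r > d`, and the Fourier transform is an
isometry. The constant does not depend on `g`, so the embeddings apply uniformly to differences and
difference quotients. -/
lemma integrable_frequency {r : ℝ} (hr : (d : ℝ) < 2 * r) :
    ∃ C, ∀ g : L2 d, Integrable (frequency r g) ∧ ∫ ξ, ‖frequency r g ξ‖ ≤ C * ‖g‖ := by
  refine ⟨‖(memLp_besselSymbol hr).toLp _‖, fun g => ?_⟩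
  have := integrable_mul_L2 (memLp_besselSymbol hr) (𝓕 g : L2 d)
  rwa [Lp.norm_fourier_eq] at this

lemma integrable_norm_mul_frequency {r : ℝ} (hr : (d : ℝ) < 2 * (r - 1)) :
    ∃ C, ∀ g : L2 d, Integrable (fun ξ => ‖ξ‖ * ‖frequency r g ξ‖) ∧
      ∫ ξ, ‖ξ‖ * ‖frequency r g ξ‖ ≤ C * ‖g‖ := by
  have hw : MemLp (fun ξ : Sp d => ‖ξ‖ * besselSymbol r ξ) 2 volume := by
    refine (memLp_besselSymbol hr).mono
      (continuous_norm.mul (continuous_besselSymbol r)).aestronglyMeasurable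
      (Eventually.of_forall fun ξ => ?_)
    rw [Real.norm_of_nonneg (mul_nonneg (norm_nonneg _) (besselSymbol_pos r ξ).le),
      Real.norm_of_nonneg (besselSymbol_pos _ ξ).le]
    exact norm_mul_besselSymbol_le r ξ
  refine ⟨‖hw.toLp _‖, fun g => ?_⟩
  have := integrable_mul_L2 hw (𝓕 g : L2 d)
  rw [Lp.norm_fourier_eq] at this
  have e : ∀ ξ : Sp d, ‖((‖ξ‖ * besselSymbol r ξ : ℝ) : ℂ) * (𝓕 g : L2 d) ξ‖
      = ‖ξ‖ * ‖frequency r g ξ‖ := fun ξ => by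
    simp [frequency, mul_assoc]
  exact ⟨this.1.norm.congr (Eventually.of_forall e), by simpa only [e] using this.2⟩

/-- On the Fourier side the multipliers of orders `r` and `-r` have product 1, so the Bessel
potential can be undone. This identifies `f` weakly, before any integrability of its Fourier
transform is known. -/
lemma HasBessel.integral_smul_eq {r : ℝ} {f : Sp d → ℝ} {g : L2 d} (h : HasBessel r f g)
    (φ : SchwartzMap (Sp d) ℂ) :
    ∫ x, φ x • (f x : ℂ) = ∫ ξ, (𝓕⁻ φ) ξ • frequency r g ξ := by
  obtain ⟨m, e⟩ := h
  set T := Lp.toTemperedDistribution (m.toLp (fun x => (f x : ℂ))) with hT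
  have hgr : ∀ a : ℝ, (fun ξ : Sp d => (((1 + ‖ξ‖ ^ 2) ^ (a / 2) : ℝ) : ℂ)).HasTemperateGrowth :=
    fun a => by fun_prop
  have h1 : smulLeftCLM ℂ (fun ξ : Sp d => (((1 + ‖ξ‖ ^ 2) ^ (r / 2) : ℝ) : ℂ)) (𝓕 T)
      = Lp.toTemperedDistribution (𝓕 g : L2 d) := by
    rw [← fourier_besselPotential_eq_smulLeftCLM_fourier_apply, e,
      Lp.fourier_toTemperedDistribution_eq]
  have h2 : 𝓕 T = smulLeftCLM ℂ (fun ξ : Sp d => (((1 + ‖ξ‖ ^ 2) ^ (-r / 2) : ℝ) : ℂ))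
      (Lp.toTemperedDistribution (𝓕 g : L2 d)) := by
    rw [← h1, smulLeftCLM_smulLeftCLM_apply (hgr r) (hgr (-r))]
    convert! (smulLeftCLM_const 1 (𝓕 T)).symm using 1
    · simp
    · congr
      ext x
      rw [Pi.mul_apply]
      norm_cast
      rw [← Real.rpow_add (by positivity)]
      ring_nf
      simp
  have h3 : T φ = (𝓕 T) (𝓕⁻ φ) := by
    rw [TemperedDistribution.fourier_apply, fourier_fourierInv_eq]
  have h4 : T φ = ∫ x, φ x • (f x : ℂ) := by
    rw [hT, Lp.toTemperedDistribution_apply]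
    refine integral_congr_ae ?_
    filter_upwards [m.coeFn_toLp] with x hx
    rw [hx]
  rw [← h4, h3, h2, smulLeftCLM_apply_apply, Lp.toTemperedDistribution_apply]
  refine integral_congr_ae (Eventually.of_forall fun ξ => ?_)
  simp only [SchwartzMap.smulLeftCLM_apply_apply (hgr (-r)), frequency, besselSymbol, smul_eq_mul]
  ring

lemma integral_fourierInv_smul {φ h : Sp d → ℂ} (hφ : Integrable φ) (hh : Integrable h) :
    ∫ ξ, (𝓕⁻ φ) ξ • h ξ = ∫ x, φ x • (𝓕⁻ h) x := by
  have := VectorFourier.integral_fourierIntegral_smul_eq_flip (μ := volume) (ν := volume)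
    (L := -innerₗ (Sp d)) (f := φ) (g := h) Real.continuous_fourierChar
    (continuous_inner (𝕜 := ℝ) (E := Sp d)).neg hφ hh
  have hL : (-innerₗ (Sp d)).flip = -innerₗ (Sp d) := by
    ext x y
    simp [real_inner_comm]
  rw [hL] at this
  exact this

lemma continuous_fourierInv {h : Sp d → ℂ} (hh : Integrable h) : Continuous (𝓕⁻ h) :=
  VectorFourier.fourierIntegral_continuous Real.continuous_fourierChar
    (continuous_inner (𝕜 := ℝ) (E := Sp d)).neg hh

lemma HasBessel.ae_eq {r : ℝ} (hr : (d : ℝ) < 2 * r) {f : Sp d → ℝ} {g : L2 d}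
    (h : HasBessel r f g) : ∀ᵐ x, (f x : ℂ) = (𝓕⁻ (frequency r g)) x := by
  obtain ⟨C, hC⟩ := integrable_frequency hr
  have hi := (hC g).1
  refine ae_eq_of_integral_contDiff_smul_eq (h.choose.locallyIntegrable one_le_two)
    (continuous_fourierInv hi).locallyIntegrable fun φ hφ hφc => ?_
  have hg₁ : HasCompactSupport (Complex.ofRealCLM ∘ φ) := hφc.comp_left rfl
  have hg₂ : ContDiff ℝ ∞ (Complex.ofRealCLM ∘ φ) := by fun_prop
  let ψ := hg₁.toSchwartzMap hg₂
  have h1 := h.integral_smul_eq ψ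
  have h2 : ∫ ξ, (𝓕⁻ ψ) ξ • frequency r g ξ = ∫ x, ψ x • (𝓕⁻ (frequency r g)) x := by
    rw [← integral_fourierInv_smul ψ.integrable hi, SchwartzMap.fourierInv_coe]
  rw [h2] at h1
  simpa [ψ] using h1

lemma HasBessel.eq {r : ℝ} (hr : (d : ℝ) < 2 * r) {f : Sp d → ℝ} {g : L2 d}
    (h : HasBessel r f g) (hf : Continuous f) (x : Sp d) :
    (f x : ℂ) = (𝓕⁻ (frequency r g)) x := by
  obtain ⟨C, hC⟩ := integrable_frequency hr
  exact congrFun (Continuous.ae_eq_iff_eq volume (Complex.continuous_ofReal.comp hf)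
    (continuous_fourierInv (hC g).1) |>.1 (h.ae_eq hr)) x

/-- Sobolev embedding `H^r ⊆ L^∞`, for `r > d / 2`. -/
lemma exists_abs_le_of_hasBessel {r : ℝ} (hr : (d : ℝ) < 2 * r) :
    ∃ C, ∀ (f : Sp d → ℝ) (g : L2 d), HasBessel r f g → Continuous f →
      ∀ x, |f x| ≤ C * ‖g‖ := by
  obtain ⟨C, hC⟩ := integrable_frequency hr
  refine ⟨C, fun f g h hf x => ?_⟩
  rw [← Real.norm_eq_abs, ← Complex.norm_real, h.eq hr hf, Real.fourierInv_eq]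
  refine (norm_integral_le_integral_norm _).trans ?_
  simpa only [Circle.norm_smul] using (hC g).2

lemma HasBessel.exists_continuous {r : ℝ} (hr : (d : ℝ) < 2 * r) {f : Sp d → ℝ} {g : L2 d}
    (h : HasBessel r f g) : ∃ f', Continuous f' ∧ f =ᵐ[volume] f' := by
  obtain ⟨C, hC⟩ := integrable_frequency hr
  refine ⟨fun x => ((𝓕⁻ (frequency r g)) x).re,
    Complex.continuous_re.comp (continuous_fourierInv (hC g).1), ?_⟩
  filter_upwards [h.ae_eq hr] with x hx
  rw [← hx, Complex.ofReal_re]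

/-- Riemann–Lebesgue lemma for the inverse Fourier integral of `frequency r g`. -/
lemma HasBessel.tendsto_zero {r : ℝ} (hr : (d : ℝ) < 2 * r) {f : Sp d → ℝ} {g : L2 d}
    (h : HasBessel r f g) (hf : Continuous f) : Tendsto f (cocompact (Sp d)) (𝓝 0) := by
  have h1 := tendsto_integral_exp_inner_smul_cocompact (frequency r g)
  have h2 : Tendsto (fun x : Sp d => -x) (cocompact (Sp d)) (cocompact (Sp d)) :=
    (Homeomorph.neg (Sp d)).isClosedEmbedding.tendsto_cocompact
  have h3 := (Complex.continuous_re.tendsto 0).comp (h1.comp h2)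
  simp only [Complex.zero_re] at h3
  refine h3.congr fun x => ?_
  simp only [Function.comp_apply]
  rw [← Complex.ofReal_re (f x), h.eq hr hf, Real.fourierInv_eq]
  simp

/-- Sobolev embedding `H^r ⊆ W^{1,∞} ∩ C^1`, for `r > 1 + d / 2`. -/
lemma exists_fderiv_le_of_hasBessel {r : ℝ} (hr : (d : ℝ) < 2 * (r - 1)) :
    ∃ C, ∀ (f : Sp d → ℝ) (g : L2 d), HasBessel r f g → Continuous f →
      ContDiff ℝ 1 f ∧ ∀ x, ‖fderiv ℝ f x‖ ≤ C * ‖g‖ := by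
  have hr0 : (d : ℝ) < 2 * r := by linarith
  obtain ⟨C₀, hC₀⟩ := integrable_frequency hr0
  obtain ⟨C, hC⟩ := integrable_norm_mul_frequency hr
  refine ⟨2 * Real.pi * ‖innerSL ℝ (E := Sp d)‖ * C, fun f g h hf => ?_⟩
  set F := 𝓕 (frequency r g) with hF
  have hfF : f = fun x => (F (-x)).re := by
    ext x
    rw [hF, ← Real.fourierInv_eq_fourier_neg, ← h.eq hr0 hf, Complex.ofReal_re]
  have hFc : ContDiff ℝ 1 F := by
    refine Real.contDiff_fourier (N := 1) fun n hn => ?_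
    have : n = 0 ∨ n = 1 := by
      have : n ≤ 1 := by exact_mod_cast hn
      omega
    rcases this with rfl | rfl
    · simpa using (hC₀ g).1.norm
    · simpa using (hC g).1
  have hd := fun x => Real.hasFDerivAt_fourier (hC₀ g).1 (hC g).1 x
  refine ⟨?_, fun x => ?_⟩
  · rw [hfF]
    exact Complex.reCLM.contDiff.comp (hFc.comp contDiff_neg)
  · have hx : HasFDerivAt f (Complex.reCLM ∘L
        ((𝓕 (VectorFourier.fourierSMulRight (innerSL ℝ) (frequency r g)) (-x)) ∘L
          (-ContinuousLinearMap.id ℝ (Sp d)))) x := by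
      rw [hfF]
      exact Complex.reCLM.hasFDerivAt.comp x ((hd (-x)).comp x (hasFDerivAt_id x).neg)
    rw [hx.fderiv]
    have hb : ‖𝓕 (VectorFourier.fourierSMulRight (innerSL ℝ) (frequency r g)) (-x)‖
        ≤ 2 * Real.pi * ‖innerSL ℝ (E := Sp d)‖ * C * ‖g‖ := by
      rw [Real.fourier_eq]
      refine (norm_integral_le_integral_norm _).trans ?_
      simp only [Circle.norm_smul]
      calc ∫ v, ‖VectorFourier.fourierSMulRight (innerSL ℝ) (frequency r g) v‖
          ≤ ∫ v, 2 * Real.pi * ‖innerSL ℝ (E := Sp d)‖ * (‖v‖ * ‖frequency r g v‖) := by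
            refine integral_mono_of_nonneg (Eventually.of_forall fun v => norm_nonneg _)
              ((hC g).1.const_mul _) (Eventually.of_forall fun v => ?_)
            refine (VectorFourier.norm_fourierSMulRight_le _ _ v).trans_eq ?_
            ring
        _ ≤ _ := by
            rw [integral_const_mul, mul_assoc _ C]
            exact mul_le_mul_of_nonneg_left (hC g).2 (by positivity)
    refine le_trans (ContinuousLinearMap.opNorm_le_bound _ (norm_nonneg _) fun y => ?_) hb
    simp only [ContinuousLinearMap.comp_apply, Complex.reCLM_apply]
    refine (Complex.abs_re_le_norm _).trans ((ContinuousLinearMap.le_opNorm _ _).trans ?_)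
    simp

/-! ### Joint regularity of Sobolev curves -/

/-- Continuity in time uniform in `x`, together with continuity in `x` at each fixed time, gives
joint continuity. -/
lemma continuousOn_of_norm_sub_le {E V : Type*} [NormedAddCommGroup E] [NormedAddCommGroup V]
    {I : Set ℝ} {F : ℝ → Sp d → E} {G : ℝ → V} (C : ℝ) (hF : ∀ t ∈ I, Continuous (F t))
    (hG : ContinuousOn G I)
    (h : ∀ t ∈ I, ∀ t' ∈ I, ∀ x, ‖F t x - F t' x‖ ≤ C * ‖G t - G t'‖) :
    ContinuousOn (fun p : ℝ × Sp d => F p.1 p.2) (I ×ˢ univ) := by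
  rintro ⟨t₀, x₀⟩ ⟨ht₀, -⟩
  have h1 : Tendsto (fun p : ℝ × Sp d => C * ‖G p.1 - G t₀‖) (𝓝[I ×ˢ univ] (t₀, x₀)) (𝓝 0) := by
    have hf : Tendsto (fun p : ℝ × Sp d => p.1) (𝓝[I ×ˢ univ] (t₀, x₀)) (𝓝[I] t₀) :=
      tendsto_nhdsWithin_iff.2 ⟨(continuous_fst.tendsto (t₀, x₀)).mono_left nhdsWithin_le_nhds,
        eventually_nhdsWithin_of_forall fun p hp => hp.1⟩
    have := (((hG t₀ ht₀).tendsto.comp hf).sub_const (G t₀)).norm.const_mul C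
    simpa using! this
  have h2 : Tendsto (fun p : ℝ × Sp d => F p.1 p.2 - F t₀ p.2) (𝓝[I ×ˢ univ] (t₀, x₀)) (𝓝 0) := by
    refine squeeze_zero_norm' ?_ h1
    filter_upwards [self_mem_nhdsWithin] with p hp
    exact h _ hp.1 _ ht₀ _
  have h3 : Tendsto (fun p : ℝ × Sp d => F t₀ p.2) (𝓝[I ×ˢ univ] (t₀, x₀)) (𝓝 (F t₀ x₀)) :=
    (((hF t₀ ht₀).comp continuous_snd).tendsto (t₀, x₀)).mono_left nhdsWithin_le_nhds
  have := h2.add h3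
  simpa [ContinuousWithinAt] using this

lemma fderiv_slice {E : Type*} [NormedAddCommGroup E] [NormedSpace ℝ E] {f : ℝ × Sp d → E}
    {t : ℝ} {x : Sp d} (hf : DifferentiableAt ℝ f (t, x)) :
    HasFDerivAt (fun y => f (t, y)) ((fderiv ℝ f (t, x)).comp (ContinuousLinearMap.inr ℝ ℝ (Sp d)))
      x :=
  hf.hasFDerivAt.comp x (hasFDerivAt_prodMk_right t x)

lemma contDiffOn_one_of_partial {I : Set ℝ} (hI : IsOpen I) {f : ℝ → Sp d → ℝ} {h : ℝ → Sp d → ℝ}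
    (ht : ∀ t ∈ I, ∀ x, HasDerivAt (fun τ => f τ x) (h t x) t)
    (hx : ∀ t ∈ I, Differentiable ℝ (f t))
    (hct : ContinuousOn (fun p : ℝ × Sp d => h p.1 p.2) (I ×ˢ univ))
    (hcx : ContinuousOn (fun p : ℝ × Sp d => fderiv ℝ (f p.1) p.2) (I ×ˢ univ)) :
    ContDiffOn ℝ 1 (fun p : ℝ × Sp d => f p.1 p.2) (I ×ˢ univ) ∧
      ∀ t ∈ I, ∀ x, fderiv ℝ (fun p : ℝ × Sp d => f p.1 p.2) (t, x) (1, 0) = h t x := by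
  have hO : IsOpen (I ×ˢ (univ : Set (Sp d))) := hI.prod isOpen_univ
  have hd : ∀ p ∈ I ×ˢ (univ : Set (Sp d)), HasFDerivAt (fun p : ℝ × Sp d => f p.1 p.2)
      ((ContinuousLinearMap.toSpanSingleton ℝ (h p.1 p.2)).coprod (fderiv ℝ (f p.1) p.2)) p := by
    intro p hp
    refine (hasStrictFDerivAt_uncurry_coprod (f := f)
      (f₁ := fun t x => ContinuousLinearMap.toSpanSingleton ℝ (h t x))
      (f₂ := fun t x => fderiv ℝ (f t) x) ?_ ?_ ?_ ?_).hasFDerivAt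
    · filter_upwards [hO.mem_nhds hp] with q hq
      exact (ht q.1 hq.1 q.2).hasFDerivAt
    · filter_upwards [hO.mem_nhds hp] with q hq
      exact (hx q.1 hq.1 q.2).hasFDerivAt
    · exact ((ContinuousLinearMap.toSpanSingletonCLE (𝕜 := ℝ) (E := ℝ)).continuous.comp_continuousOn
        hct).continuousAt (hO.mem_nhds hp)
    · exact hcx.continuousAt (hO.mem_nhds hp)
  refine ⟨?_, fun t ht' x => ?_⟩
  · have : (1 : WithTop ℕ∞) = 0 + 1 := by simp
    rw [this, contDiffOn_succ_iff_fderiv_of_isOpen hO]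
    refine ⟨fun p hp => (hd p hp).differentiableAt.differentiableWithinAt, by simp, ?_⟩
    rw [contDiffOn_zero]
    refine ContinuousOn.congr ?_ fun p hp => (hd p hp).fderiv
    have h1 := (ContinuousLinearMap.toSpanSingletonCLE (𝕜 := ℝ) (E := ℝ)).continuous.comp_continuousOn
        hct
    refine ((h1.clm_comp (continuousOn_const (c := ContinuousLinearMap.fst ℝ ℝ (Sp d)))).add
      (hcx.clm_comp (continuousOn_const (c := ContinuousLinearMap.snd ℝ ℝ (Sp d))))).congr
      fun p _ => ?_
    ext <;> simp
  · rw [(hd (t, x) ⟨ht', mem_univ _⟩).fderiv]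
    simp

/-- Two embeddings are combined: order `s - 1` controls the sup norm and hence the time derivative,
while order `s` controls the spatial gradient. -/
lemma contDiffOn_of_contInH {s : ℝ} (hs : 1 + (d : ℝ) / 2 < s) {I : Set ℝ} (hI : IsOpen I)
    {f f' : ℝ → Sp d → ℝ} (hf : ∀ t ∈ I, Continuous (f t)) (h0 : ContInH s I f)
    (h1 : C1InH (s - 1) I f f') :
    ContDiffOn ℝ 1 (fun p : ℝ × Sp d => f p.1 p.2) (I ×ˢ univ) ∧
    (∀ t ∈ I, f' t =ᵐ[volume] fun x => fderiv ℝ (fun p : ℝ × Sp d => f p.1 p.2) (t, x) (1, 0)) ∧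
    ∀ K ⊆ I, IsCompact K → ∃ L, ∀ t ∈ K, ∀ x, ‖fderiv ℝ (f t) x‖ ≤ L := by
  obtain ⟨G₀, hG₀, hB₀⟩ := h0
  obtain ⟨G, G', hG', hB⟩ := h1
  have hs1 : (d : ℝ) < 2 * (s - 1) := by linarith
  obtain ⟨C₁, hC₁⟩ := exists_abs_le_of_hasBessel hs1
  obtain ⟨C₂, hC₂⟩ := exists_fderiv_le_of_hasBessel hs1
  -- The time derivative is only given as a class modulo null sets; `h` is its continuous
  -- representative.
  have hrep : ∀ t, ∃ g : Sp d → ℝ, t ∈ I → Continuous g ∧ f' t =ᵐ[volume] g := fun t => by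
    by_cases ht : t ∈ I
    · obtain ⟨g, hg⟩ := (hB t ht).2.2.exists_continuous hs1
      exact ⟨g, fun _ => hg⟩
    · exact ⟨0, fun h => absurd h ht⟩
  choose h hh using hrep
  have hBh : ∀ t ∈ I, HasBessel (s - 1) (h t) (G' t) := fun t ht =>
    (hB t ht).2.2.congr_ae (hh t ht).2
  have hdiff : ∀ t ∈ I, Differentiable ℝ (f t) := fun t ht =>
    (hC₂ _ _ (hB₀ t ht) (hf t ht)).1.differentiable (by simp)
  have hct : ContinuousOn (fun p : ℝ × Sp d => h p.1 p.2) (I ×ˢ univ) := by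
    refine continuousOn_of_norm_sub_le C₁ (fun t ht => (hh t ht).1) hG' fun t ht t' ht' x => ?_
    exact hC₁ _ _ ((hBh t ht).sub (hBh t' ht')) ((hh t ht).1.sub (hh t' ht').1) x
  have hcx : ContinuousOn (fun p : ℝ × Sp d => fderiv ℝ (f p.1) p.2) (I ×ˢ univ) := by
    refine continuousOn_of_norm_sub_le C₂ (fun t ht =>
      (hC₂ _ _ (hB₀ t ht) (hf t ht)).1.continuous_fderiv (by simp)) hG₀ fun t ht t' ht' x => ?_
    have := (hC₂ _ _ ((hB₀ t ht).sub (hB₀ t' ht')) ((hf t ht).sub (hf t' ht'))).2 x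
    have h2 : HasFDerivAt (fun x => f t x - f t' x) (fderiv ℝ (f t) x - fderiv ℝ (f t') x) x :=
      (hdiff t ht x).hasFDerivAt.sub (hdiff t' ht' x).hasFDerivAt
    rwa [h2.fderiv] at this
  -- The sup-norm embedding applied to "difference quotient minus derivative" turns the derivative
  -- in `H^{s-1}` into a pointwise one.
  have htime : ∀ t ∈ I, ∀ x, HasDerivAt (fun τ => f τ x) (h t x) t := by
    intro t ht x
    rw [hasDerivAt_iff_tendsto_slope, tendsto_iff_norm_sub_tendsto_zero]
    have hsl := (hasDerivAt_iff_tendsto_slope.1 (hB t ht).1)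
    rw [tendsto_iff_norm_sub_tendsto_zero] at hsl
    refine squeeze_zero' (Eventually.of_forall fun _ => norm_nonneg _) ?_
      (by simpa using hsl.const_mul C₁)
    filter_upwards [mem_nhdsWithin_of_mem_nhds (hI.mem_nhds ht)] with τ hτ
    have hb : HasBessel (s - 1) (fun x => (τ - t)⁻¹ * (f τ x - f t x) - h t x)
        ((τ - t)⁻¹ • (G τ - G t) - G' t) :=
      (((hB τ hτ).2.1.sub (hB t ht).2.1).const_mul _).sub (hBh t ht)
    have := hC₁ _ _ hb ((continuous_const.mul ((hf τ hτ).sub (hf t ht))).sub (hh t ht).1) x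
    simpa [slope, Real.norm_eq_abs] using this
  obtain ⟨r1, r2⟩ := contDiffOn_one_of_partial hI htime hdiff hct hcx
  refine ⟨r1, fun t ht => ?_, fun K hK hKc => ?_⟩
  · filter_upwards [(hh t ht).2] with x hx
    rw [hx, r2 t ht]
  · obtain ⟨M, hM⟩ := hKc.exists_bound_of_continuousOn (hG₀.mono hK)
    refine ⟨|C₂| * M, fun t ht x => ?_⟩
    refine ((hC₂ _ _ (hB₀ t (hK ht)) (hf t (hK ht))).2 x).trans ?_
    exact mul_le_mul (le_abs_self _) (hM t ht) (norm_nonneg _) (abs_nonneg _)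

/-- The divergence at a point, as a continuous linear function of the differential. -/
def traceL (d : ℕ) : (Sp d →L[ℝ] Sp d) →L[ℝ] ℝ :=
  LinearMap.toContinuousLinearMap
    ((LinearMap.trace ℝ (Sp d)) ∘ₗ
      (ContinuousLinearMap.coeLM ℝ : (Sp d →L[ℝ] Sp d) →ₗ[ℝ] (Sp d →ₗ[ℝ] Sp d)))

lemma divergence_eq (v : Sp d → Sp d) (x : Sp d) : divergence v x = traceL d (fderiv ℝ v x) := rfl

/-- `(c, u)` is a classical solution, on the time interval `I`, of the symmetric form of the Euler
system with `κ = 1 / n`, and its gradient is bounded on each compact set of times. -/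
structure IsClassicalSolution (n : ℕ) (I : Set ℝ) (c : ℝ × Sp d → ℝ) (u : ℝ × Sp d → Sp d) :
    Prop where
  isOpen : IsOpen I
  contDiffOn_c : ContDiffOn ℝ 1 c (I ×ˢ univ)
  contDiffOn_u : ContDiffOn ℝ 1 u (I ×ˢ univ)
  bound_c : ∀ K ⊆ I, IsCompact K → ∃ L, ∀ t ∈ K, ∀ x, ‖fderiv ℝ (fun y => c (t, y)) x‖ ≤ L
  bound_u : ∀ K ⊆ I, IsCompact K → ∃ L, ∀ t ∈ K, ∀ x, ‖fderiv ℝ (fun y => u (t, y)) x‖ ≤ L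
  eq_c : ∀ t ∈ I, ∀ x, fderiv ℝ c (t, x) (1, u (t, x))
    = -(1 / n * c (t, x) * divergence (fun y => u (t, y)) x)
  eq_u : ∀ t ∈ I, ∀ x, fderiv ℝ u (t, x) (1, u (t, x))
    = -((n * c (t, x)) • gradient (fun y => c (t, y)) x)

lemma fderiv_apply_eq_zero_add {E : Type*} [NormedAddCommGroup E] [NormedSpace ℝ E]
    (A : ℝ × Sp d →L[ℝ] E) (v : Sp d) :
    A (1, v) = A (1, 0) + A.comp (ContinuousLinearMap.inr ℝ ℝ (Sp d)) v := by
  rw [ContinuousLinearMap.comp_apply, ContinuousLinearMap.inr_apply, ← map_add]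
  simp

lemma norm_fderiv_le_sum {v : Sp d → Sp d} {x : Sp d} (hv : DifferentiableAt ℝ v x) :
    ‖fderiv ℝ v x‖ ≤ ∑ i, ‖fderiv ℝ (fun y => v y i) x‖ := by
  refine ContinuousLinearMap.opNorm_le_bound _ (Finset.sum_nonneg fun _ _ => norm_nonneg _)
    fun y => ?_
  have hi : ∀ i, fderiv ℝ (fun y => v y i) x y = (fderiv ℝ v x y) i := fun i => by
    have := ((EuclideanSpace.proj (𝕜 := ℝ) i).hasFDerivAt (x := v x)).comp x hv.hasFDerivAt
    have h2 : HasFDerivAt (fun y => v y i) ((EuclideanSpace.proj (𝕜 := ℝ) i).comp (fderiv ℝ v x)) x :=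
      this
    rw [h2.fderiv]
    simp
  have hsum : ∀ w : Sp d, ‖w‖ ≤ ∑ i, ‖w i‖ := fun w => by
    conv_lhs => rw [← (EuclideanSpace.basisFun (Fin d) ℝ).sum_repr w]
    refine (norm_sum_le _ _).trans (Finset.sum_le_sum fun i _ => ?_)
    rw [norm_smul]
    simp
  refine (hsum _).trans ?_
  rw [Finset.sum_mul]
  refine Finset.sum_le_sum fun i _ => ?_
  rw [← hi]
  exact ContinuousLinearMap.le_opNorm _ _

/-- With `κ = 1 / n` one has `c̄ = n c`. The equations hold almost everywhere, hence everywhere,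
both sides being continuous. -/
lemma IsSolution.isClassicalSolution {γ s : ℝ} (hs : 1 + (d : ℝ) / 2 < s) {n : ℕ} (hn : n ≠ 0)
    (hκ : kappa γ = 1 / n) {c₀ : Sp d → ℝ} {u₀ : Sp d → Sp d} {I : Set ℝ} (hI : IsOpen I)
    {c : ℝ → Sp d → ℝ} {u : ℝ → Sp d → Sp d} (h : IsSolution γ s c₀ u₀ I c u) :
    IsClassicalSolution n I (fun p => c p.1 p.2) (fun p => u p.1 p.2) := by
  obtain ⟨-, -, hcont, hc, hu, ct, ut, hct, hut, heq⟩ := h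
  have hO : IsOpen (I ×ˢ (univ : Set (Sp d))) := hI.prod isOpen_univ
  obtain ⟨c1, c2, c3⟩ := contDiffOn_of_contInH hs hI (fun t ht => (hcont t ht).1) hc hct
  have hui := fun i => contDiffOn_of_contInH hs hI (f := fun t x => u t x i)
    (fun t ht => (EuclideanSpace.proj (𝕜 := ℝ) i).continuous.comp (hcont t ht).2) (hu i) (hut i)
  have u1 : ContDiffOn ℝ 1 (fun p : ℝ × Sp d => u p.1 p.2) (I ×ˢ univ) :=
    contDiffOn_euclidean.2 fun i => (hui i).1
  have dc : ∀ t ∈ I, ∀ x, DifferentiableAt ℝ (fun p : ℝ × Sp d => c p.1 p.2) (t, x) :=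
    fun t ht x => (c1.differentiableOn (by simp)).differentiableAt (hO.mem_nhds ⟨ht, mem_univ _⟩)
  have du : ∀ t ∈ I, ∀ x, DifferentiableAt ℝ (fun p : ℝ × Sp d => u p.1 p.2) (t, x) :=
    fun t ht x => (u1.differentiableOn (by simp)).differentiableAt (hO.mem_nhds ⟨ht, mem_univ _⟩)
  have dcx : ∀ t ∈ I, ∀ x, HasFDerivAt (c t)
      ((fderiv ℝ (fun p : ℝ × Sp d => c p.1 p.2) (t, x)).comp
        (ContinuousLinearMap.inr ℝ ℝ (Sp d))) x := fun t ht x => fderiv_slice (dc t ht x)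
  have dux : ∀ t ∈ I, ∀ x, HasFDerivAt (u t)
      ((fderiv ℝ (fun p : ℝ × Sp d => u p.1 p.2) (t, x)).comp
        (ContinuousLinearMap.inr ℝ ℝ (Sp d))) x := fun t ht x => fderiv_slice (du t ht x)
  have hut' : ∀ t ∈ I, ut t =ᵐ[volume]
      fun x => fderiv ℝ (fun p : ℝ × Sp d => u p.1 p.2) (t, x) (1, 0) := fun t ht => by
    have : ∀ᵐ x, ∀ i, ut t x i = fderiv ℝ (fun p : ℝ × Sp d => u p.1 p.2 i) (t, x) (1, 0) :=
      ae_all_iff.2 fun i => (hui i).2.1 t ht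
    filter_upwards [this] with x hx
    ext i
    rw [hx i]
    have h2 : HasFDerivAt (fun p : ℝ × Sp d => u p.1 p.2 i) ((EuclideanSpace.proj (𝕜 := ℝ) i).comp
        (fderiv ℝ (fun p : ℝ × Sp d => u p.1 p.2) (t, x))) (t, x) :=
      ((EuclideanSpace.proj (𝕜 := ℝ) i).hasFDerivAt).comp (t, x) (du t ht x).hasFDerivAt
    rw [h2.fderiv]
    simp
  have slice : ∀ t ∈ I, Continuous fun x : Sp d => (t, x) := fun t _ => by fun_prop
  have cfc : ∀ t ∈ I, Continuous fun x => fderiv ℝ (fun p : ℝ × Sp d => c p.1 p.2) (t, x) :=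
    fun t ht => (c1.continuousOn_fderiv_of_isOpen hO le_rfl).comp_continuous (slice t ht)
      fun x => ⟨ht, mem_univ _⟩
  have cfu : ∀ t ∈ I, Continuous fun x => fderiv ℝ (fun p : ℝ × Sp d => u p.1 p.2) (t, x) :=
    fun t ht => (u1.continuousOn_fderiv_of_isOpen hO le_rfl).comp_continuous (slice t ht)
      fun x => ⟨ht, mem_univ _⟩
  have cdc : ∀ t ∈ I, Continuous fun x => fderiv ℝ (c t) x := fun t ht => by
    simp_rw [fun x => (dcx t ht x).fderiv]
    exact (cfc t ht).clm_comp continuous_const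
  have cdu : ∀ t ∈ I, Continuous fun x => fderiv ℝ (u t) x := fun t ht => by
    simp_rw [fun x => (dux t ht x).fderiv]
    exact (cfu t ht).clm_comp continuous_const
  have hk : (n : ℝ) ≠ 0 := by exact_mod_cast hn
  have hdiv : ∀ t ∈ I, ∀ x, fderiv ℝ (fun y => c t y / kappa γ) x = (n : ℝ) • fderiv ℝ (c t) x :=
    fun t ht x => by
      have : (fun y => c t y / kappa γ) = fun y => c t y * n := by
        ext y
        rw [hκ]
        field_simp
      rw [this, ((dcx t ht x).mul_const (n : ℝ)).fderiv, (dcx t ht x).fderiv]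
  have hgrad : ∀ t ∈ I, ∀ x, gradient (fun y => c t y / kappa γ) x = (n : ℝ) • gradient (c t) x :=
    fun t ht x => by
      simp [gradient, hdiv t ht x]
  refine ⟨hI, c1, u1, c3, fun K hK hKc => ?_, fun t ht => ?_, fun t ht => ?_⟩
  · choose L hL using fun i => (hui i).2.2 K hK hKc
    refine ⟨∑ i, L i, fun t ht x => (norm_fderiv_le_sum ?_).trans
      (Finset.sum_le_sum fun i _ => hL i t ht x)⟩
    exact (dux t (hK ht) x).differentiableAt
  · refine congrFun ((Continuous.ae_eq_iff_eq volume ?_ ?_).1 ?_)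
    · exact (cfc t ht).clm_apply (continuous_const.prodMk (hcont t ht).2)
    · have h1 : Continuous fun x => traceL d (fderiv ℝ (u t) x) :=
        (traceL d).continuous.comp (cdu t ht)
      exact ((continuous_const.mul (hcont t ht).1).mul h1).neg
    · filter_upwards [heq t ht, c2 t ht] with x h1 h2
      have h3 := h1.1
      rw [hdiv t ht x, (dcx t ht x).fderiv, h2, hκ] at h3
      rw [fderiv_apply_eq_zero_add]
      have h4 : ∀ a b e D : ℝ, a / (1 / n) + n * b + 1 / n * (e / (1 / n)) * D = 0 →
          a + b = -(1 / n * e * D) := fun a b e D h => by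
        field_simp at h ⊢
        linear_combination h
      exact h4 _ _ _ _ h3
  · refine congrFun ((Continuous.ae_eq_iff_eq volume ?_ ?_).1 ?_)
    · exact (cfu t ht).clm_apply (continuous_const.prodMk (hcont t ht).2)
    · exact ((continuous_const.mul (hcont t ht).1).smul
        ((InnerProductSpace.toDual ℝ (Sp d)).symm.continuous.comp (cdc t ht))).neg
    · filter_upwards [heq t ht, hut' t ht] with x h1 h2
      have h3 := h1.2
      rw [hgrad t ht x, (dux t ht x).fderiv, h2, hκ, smul_smul] at h3
      have h4 : 1 / (n : ℝ) * (c t x / (1 / n)) * n = n * c t x := by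
        field_simp
      rw [h4] at h3
      rw [fderiv_apply_eq_zero_add, eq_neg_iff_add_eq_zero]
      exact h3

/-! ### Propagation of the vacuum -/

namespace IsClassicalSolution

variable {n : ℕ} {I : Set ℝ} {c : ℝ × Sp d → ℝ} {u : ℝ × Sp d → Sp d}

lemma mem_nhds (h : IsClassicalSolution n I c u) {t : ℝ} (ht : t ∈ I) (x : Sp d) :
    I ×ˢ (univ : Set (Sp d)) ∈ 𝓝 (t, x) :=
  (h.isOpen.prod isOpen_univ).mem_nhds ⟨ht, mem_univ _⟩

lemma differentiableAt_c (h : IsClassicalSolution n I c u) {t : ℝ} (ht : t ∈ I) (x : Sp d) :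
    DifferentiableAt ℝ c (t, x) :=
  (h.contDiffOn_c.differentiableOn (by simp)).differentiableAt (h.mem_nhds ht x)

lemma differentiableAt_u (h : IsClassicalSolution n I c u) {t : ℝ} (ht : t ∈ I) (x : Sp d) :
    DifferentiableAt ℝ u (t, x) :=
  (h.contDiffOn_u.differentiableOn (by simp)).differentiableAt (h.mem_nhds ht x)

/-- The equations control the derivative along `(1, u)`. Passing to another velocity `v` costs a
term linear in `u - v`, as Grönwall's inequality requires; `v = 0` gives the time derivative in the
minimum principle. -/
lemma fderiv_c_apply (h : IsClassicalSolution n I c u) {t : ℝ} (ht : t ∈ I) (x v : Sp d) :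
    fderiv ℝ c (t, x) (1, v) = fderiv ℝ c (t, x) (1, u (t, x))
      - fderiv ℝ (fun y => c (t, y)) x (u (t, x) - v) := by
  rw [(fderiv_slice (h.differentiableAt_c ht x)).fderiv, ContinuousLinearMap.comp_apply,
    ContinuousLinearMap.inr_apply, ← map_sub]
  simp

lemma fderiv_u_apply (h : IsClassicalSolution n I c u) {t : ℝ} (ht : t ∈ I) (x v : Sp d) :
    fderiv ℝ u (t, x) (1, v) = fderiv ℝ u (t, x) (1, u (t, x))
      - fderiv ℝ (fun y => u (t, y)) x (u (t, x) - v) := by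
  rw [(fderiv_slice (h.differentiableAt_u ht x)).fderiv, ContinuousLinearMap.comp_apply,
    ContinuousLinearMap.inr_apply, ← map_sub]
  simp

/-- Along the line of constant velocity `v = u (t₀, x)`, the pair `(c, u - v)` vanishes at `t₀` and
its derivative is bounded by a multiple of itself, so Grönwall makes it vanish. No flow map of `u`
has to be constructed. -/
lemma eq_along_line (h : IsClassicalSolution n I c u) {t₀ t₁ : ℝ} (hI : Icc t₀ t₁ ⊆ I)
    {x : Sp d} (hx : c (t₀, x) = 0) {t : ℝ} (ht : t ∈ Icc t₀ t₁) :
    c (t, x + (t - t₀) • u (t₀, x)) = 0 ∧ u (t, x + (t - t₀) • u (t₀, x)) = u (t₀, x) := by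
  obtain ⟨Lc, hLc⟩ := h.bound_c _ hI isCompact_Icc
  obtain ⟨Lu, hLu⟩ := h.bound_u _ hI isCompact_Icc
  have hLc0 : 0 ≤ Lc := (norm_nonneg _).trans (hLc t ht x)
  have hLu0 : 0 ≤ Lu := (norm_nonneg _).trans (hLu t ht x)
  set v := u (t₀, x) with hv
  set p : ℝ → ℝ × Sp d := fun τ => (τ, x + (τ - t₀) • v) with hp
  have hpd : ∀ τ, HasDerivAt p (1, v) τ := fun τ => by
    have h1 : HasDerivAt (fun τ : ℝ => x + (τ - t₀) • v) v τ := by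
      simpa using! (((hasDerivAt_id τ).sub_const t₀).smul_const v).const_add x
    exact (hasDerivAt_id τ).prodMk h1
  have hcd : ∀ τ ∈ Icc t₀ t₁, HasDerivAt (fun τ => (c (p τ), u (p τ) - v))
      (fderiv ℝ c (p τ) (1, v), fderiv ℝ u (p τ) (1, v)) τ := fun τ hτ =>
    ((h.differentiableAt_c (hI hτ) _).hasFDerivAt.comp_hasDerivAt τ (hpd τ)).prodMk
      (((h.differentiableAt_u (hI hτ) _).hasFDerivAt.comp_hasDerivAt τ (hpd τ)).sub_const v)
  -- The first two terms bound the component `c`, the last two the component `u - v`; their sum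
  -- serves for the sup norm of the pair.
  set K := 1 / (n : ℝ) * (‖traceL d‖ * Lu) + Lc + n * Lc + Lu with hK
  have hbound : ∀ τ ∈ Ico t₀ t₁, ‖(fderiv ℝ c (p τ) (1, v), fderiv ℝ u (p τ) (1, v))‖
      ≤ K * ‖(c (p τ), u (p τ) - v)‖ + 0 := by
    intro τ hτ
    have hτ' : τ ∈ Icc t₀ t₁ := Ico_subset_Icc_self hτ
    have hτI := hI hτ'
    set N := ‖(c (p τ), u (p τ) - v)‖ with hN
    have hN0 : 0 ≤ N := norm_nonneg _
    have hc : |c (p τ)| ≤ N := norm_fst_le (c (p τ), u (p τ) - v)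
    have hu : ‖u (p τ) - v‖ ≤ N := norm_snd_le (c (p τ), u (p τ) - v)
    rw [add_zero, norm_prod_le_iff]
    constructor
    · rw [h.fderiv_c_apply hτI, h.eq_c _ hτI, divergence_eq]
      refine (norm_sub_le _ _).trans ?_
      have e1 : ‖-(1 / (n : ℝ) * c (p τ) * traceL d (fderiv ℝ (fun y => u (τ, y)) (p τ).2))‖
          ≤ 1 / (n : ℝ) * N * (‖traceL d‖ * Lu) := by
        rw [norm_neg, norm_mul, norm_mul, Real.norm_of_nonneg (by positivity : 0 ≤ 1 / (n : ℝ))]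
        gcongr
        · exact hc
        · refine (ContinuousLinearMap.le_opNorm _ _).trans ?_
          gcongr
          exact hLu _ hτ' _
      have e2 : ‖fderiv ℝ (fun y => c (τ, y)) (p τ).2 (u (p τ) - v)‖ ≤ Lc * N := by
        refine (ContinuousLinearMap.le_opNorm _ _).trans ?_
        gcongr
        exact hLc _ hτ' _
      calc _ ≤ 1 / (n : ℝ) * N * (‖traceL d‖ * Lu) + Lc * N := add_le_add e1 e2
        _ ≤ K * N := by
            have : 0 ≤ (n * Lc + Lu) * N := by positivity
            rw [hK]
            linarith
    · rw [h.fderiv_u_apply hτI, h.eq_u _ hτI]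
      refine (norm_sub_le _ _).trans ?_
      have e1 : ‖-(((n : ℝ) * c (p τ)) • gradient (fun y => c (τ, y)) (p τ).2)‖
          ≤ n * N * Lc := by
        rw [norm_neg, norm_smul, norm_mul, Real.norm_of_nonneg (Nat.cast_nonneg n)]
        gcongr
        · exact hc
        · rw [gradient, LinearIsometryEquiv.norm_map]
          exact hLc _ hτ' _
      have e2 : ‖fderiv ℝ (fun y => u (τ, y)) (p τ).2 (u (p τ) - v)‖ ≤ Lu * N := by
        refine (ContinuousLinearMap.le_opNorm _ _).trans ?_
        gcongr
        exact hLu _ hτ' _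
      calc _ ≤ n * N * Lc + Lu * N := add_le_add e1 e2
        _ ≤ K * N := by
            have : 0 ≤ (1 / (n : ℝ) * (‖traceL d‖ * Lu) + Lc) * N := by positivity
            rw [hK]
            linarith
  have hz := norm_le_gronwallBound_of_norm_deriv_right_le (f := fun τ => (c (p τ), u (p τ) - v))
    (δ := 0) (K := K) (ε := 0) (a := t₀) (b := t₁)
    (fun τ hτ => (hcd τ hτ).continuousAt.continuousWithinAt)
    (fun τ hτ => (hcd τ (Ico_subset_Icc_self hτ)).hasDerivWithinAt)
    (by simp [hp, hx, ← hv]) hbound t ht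
  rw [gronwallBound_ε0, zero_mul, norm_le_zero_iff, Prod.mk_eq_zero, sub_eq_zero] at hz
  exact hz

/-- On `{‖y‖ ≥ R}` there is vacuum, and the velocity is at most `ε`. -/
def QuietOutside (c : Sp d → ℝ) (u : Sp d → Sp d) (ε R : ℝ) : Prop :=
  ∀ y, R ≤ ‖y‖ → c y = 0 ∧ ‖u y‖ ≤ ε

/-- A far point `y` at time `t₁` lies on the line issued from `x` at time `t₀` when `x = y - δ u
(t₀, x)`. This is a fixed point problem, contracting for `δ L < 1`, on a ball around `y` that stays
where the gas is quiet. The velocity is then inherited from `x`. -/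
lemma quietOutside_step (h : IsClassicalSolution n I c u) {t₀ t₁ L ε R : ℝ}
    (hI : Icc t₀ t₁ ⊆ I) (hL : ∀ x, ‖fderiv ℝ (fun y => u (t₀, y)) x‖ ≤ L) (hε : 0 ≤ ε)
    (hδ : (t₁ - t₀) * L < 1) (hq : QuietOutside (fun y => c (t₀, y)) (fun y => u (t₀, y)) ε R)
    (ht : t₀ ≤ t₁) :
    QuietOutside (fun y => c (t₁, y)) (fun y => u (t₁, y)) ε (R + ε * (t₁ - t₀)) := by
  intro y hy
  set δ := t₁ - t₀ with hδd
  have hδ0 : 0 ≤ δ := sub_nonneg.2 ht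
  have ht₀ : t₀ ∈ I := hI ⟨le_rfl, ht⟩
  have hL0 : 0 ≤ L := (norm_nonneg _).trans (hL y)
  set Φ : Sp d → Sp d := fun x => y - δ • u (t₀, x) with hΦ
  set S := Metric.closedBall y (ε * δ) with hS
  have hSR : ∀ x ∈ S, R ≤ ‖x‖ := fun x hx => by
    have h1 : ‖y‖ - ‖x‖ ≤ ‖y - x‖ := norm_sub_norm_le y x
    rw [hS, mem_closedBall_iff_norm'] at hx
    linarith
  have hmaps : MapsTo Φ S S := fun x hx => by
    have := (hq x (hSR x hx)).2
    rw [hS, mem_closedBall_iff_norm', hΦ]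
    simp only [sub_sub_cancel, norm_smul, Real.norm_of_nonneg hδ0]
    rw [mul_comm]
    gcongr
  have hlip : LipschitzWith (δ * L).toNNReal Φ := by
    refine LipschitzWith.of_dist_le_mul fun x x' => ?_
    rw [Real.coe_toNNReal _ (mul_nonneg hδ0 hL0), dist_eq_norm, dist_eq_norm]
    have h1 := Convex.norm_image_sub_le_of_norm_fderiv_le (𝕜 := ℝ) (f := fun y => u (t₀, y))
      (s := univ) (x := x) (y := x')
      (fun z _ => (fderiv_slice (h.differentiableAt_u ht₀ z)).differentiableAt)
      (fun z _ => hL z) convex_univ (mem_univ _) (mem_univ _)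
    have h2 : Φ x - Φ x' = δ • (u (t₀, x') - u (t₀, x)) := by
      simp only [hΦ, smul_sub]
      abel
    rw [h2, norm_smul, Real.norm_of_nonneg hδ0, mul_assoc, norm_sub_rev x x']
    gcongr
  have hcontr : ContractingWith (δ * L).toNNReal (hmaps.restrict Φ S S) :=
    ⟨by rw [← NNReal.coe_lt_coe, Real.coe_toNNReal _ (mul_nonneg hδ0 hL0)]; exact hδ,
      fun a b => hlip a b⟩
  obtain ⟨x, hxS, hx, -⟩ := hcontr.exists_fixedPoint' Metric.isClosed_closedBall.isComplete hmaps
    (Metric.mem_closedBall_self (by positivity : 0 ≤ ε * δ)) (edist_ne_top _ _)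
  obtain ⟨hc, hu⟩ := hq x (hSR x hxS)
  have hxy : y = x + (t₁ - t₀) • u (t₀, x) := by
    have : y - δ • u (t₀, x) = x := hx
    rw [← hδd, ← sub_eq_iff_eq_add]
    exact this
  obtain ⟨e1, e2⟩ := h.eq_along_line hI hc (t := t₁) ⟨ht, le_rfl⟩
  rw [← hxy] at e1 e2
  exact ⟨e1, by simpa only [e2] using hu⟩

/-- Equal time steps, short enough for the contraction. The bound `ε` is not degraded from one step
to the next, and the radii add up. -/
lemma quietOutside (h : IsClassicalSolution n I c u) {T ε R : ℝ} (hI : Icc 0 T ⊆ I) (hε : 0 ≤ ε)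
    (hq : QuietOutside (fun y => c (0, y)) (fun y => u (0, y)) ε R) {t : ℝ} (ht : t ∈ Icc 0 T) :
    QuietOutside (fun y => c (t, y)) (fun y => u (t, y)) ε (R + ε * t) := by
  obtain ⟨L, hL⟩ := h.bound_u _ hI isCompact_Icc
  have hL0 : 0 ≤ L := (norm_nonneg _).trans (hL t ht 0)
  obtain ⟨N, hN⟩ := exists_nat_gt (t * L)
  have hN0 : (0 : ℝ) < N := (mul_nonneg ht.1 hL0).trans_lt hN
  have key : ∀ k : ℕ, k ≤ N → QuietOutside (fun y => c (k * (t / N), y))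
      (fun y => u (k * (t / N), y)) ε (R + ε * (k * (t / N))) := by
    intro k
    induction k with
    | zero => intro _; simpa using hq
    | succ k ih =>
      intro hk
      have hk' : ((k + 1 : ℕ) : ℝ) * (t / N) ≤ t := by
        rw [mul_div_assoc', div_le_iff₀ hN0, mul_comm]
        exact mul_le_mul_of_nonneg_left (by exact_mod_cast hk) ht.1
      have hd : ((k + 1 : ℕ) : ℝ) * (t / N) - k * (t / N) = t / N := by
        push_cast
        ring
      have htN : 0 ≤ t / N := div_nonneg ht.1 hN0.le
      have hle : (k : ℝ) * (t / N) ≤ ((k + 1 : ℕ) : ℝ) * (t / N) := by linarith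
      have hk0 : (0 : ℝ) ≤ k * (t / N) := by positivity
      have := h.quietOutside_step (t₀ := k * (t / N)) (t₁ := (k + 1 : ℕ) * (t / N)) (L := L)
        (fun τ hτ => hI ⟨hk0.trans hτ.1, hτ.2.trans (hk'.trans ht.2)⟩)
        (hL _ ⟨hk0, hle.trans (hk'.trans ht.2)⟩) hε
        (by rw [hd, div_mul_eq_mul_div, div_lt_one hN0]; exact hN) (ih (by omega)) hle
      rwa [add_assoc, ← mul_add, add_sub_cancel] at this
  have := key N le_rfl
  rwa [mul_div_cancel₀ t hN0.ne'] at this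

/-- The sound speed stays nonnegative, by the minimum principle. -/
lemma nonneg (h : IsClassicalSolution n I c u) {T R : ℝ} (hI : Icc 0 T ⊆ I)
    (h0 : ∀ x, 0 ≤ c (0, x)) (hR : ∀ t ∈ Icc 0 T, ∀ x, R ≤ ‖x‖ → c (t, x) = 0) {t : ℝ}
    (ht : t ∈ Icc 0 T) (x : Sp d) : 0 ≤ c (t, x) := by
  obtain ⟨L, hL⟩ := h.bound_u _ hI isCompact_Icc
  by_contra hneg
  push Not at hneg
  -- The extra 1 makes `K` strictly larger than `|div u| / n`, which is what contradicts a negative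
  -- minimum of the weighted function `f`.
  set K := 1 / (n : ℝ) * (‖traceL d‖ * L) + 1 with hK
  set f : ℝ × Sp d → ℝ := fun p => Real.exp (-K * p.1) * c p with hf
  have hxR : ‖x‖ < R := by
    by_contra hx
    rw [hR t ht x (not_lt.1 hx)] at hneg
    exact lt_irrefl _ hneg
  have hcont : ContinuousOn f (Icc 0 T ×ˢ Metric.closedBall 0 R) :=
    (Real.continuous_exp.comp (continuous_const.mul continuous_fst)).continuousOn.mul
      (h.contDiffOn_c.continuousOn.mono (prod_mono hI (subset_univ _)))
  have hmem : (t, x) ∈ Icc 0 T ×ˢ Metric.closedBall (0 : Sp d) R :=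
    ⟨ht, mem_closedBall_zero_iff.2 hxR.le⟩
  obtain ⟨⟨t₁, x₁⟩, ⟨ht₁, hx₁⟩, hmin⟩ :=
    (isCompact_Icc.prod (isCompact_closedBall (0 : Sp d) R)).exists_isMinOn ⟨_, hmem⟩ hcont
  have hf1 : f (t₁, x₁) < 0 :=
    (hmin hmem).trans_lt (mul_neg_of_pos_of_neg (Real.exp_pos _) hneg)
  have hc1 : c (t₁, x₁) < 0 := by
    by_contra hc
    exact absurd hf1 (not_lt.2 (mul_nonneg (Real.exp_pos _).le (not_lt.1 hc)))
  have hx₁' : ‖x₁‖ < R := by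
    by_contra hx
    rw [hR t₁ ht₁ x₁ (not_lt.1 hx)] at hc1
    exact lt_irrefl _ hc1
  have ht₁0 : 0 < t₁ := by
    refine lt_of_le_of_ne ht₁.1 fun h' => ?_
    rw [← h'] at hc1
    exact absurd hc1 (not_lt.2 (h0 x₁))
  have hspace : fderiv ℝ (fun y => c (t₁, y)) x₁ = 0 := by
    refine IsLocalMin.fderiv_eq_zero ?_
    filter_upwards [Metric.isOpen_ball.mem_nhds (mem_ball_zero_iff.2 hx₁')] with y hy
    have : f (t₁, x₁) ≤ f (t₁, y) := hmin ⟨ht₁, Metric.ball_subset_closedBall hy⟩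
    exact le_of_mul_le_mul_left this (Real.exp_pos _)
  have hct : HasDerivAt (fun τ => c (τ, x₁)) (fderiv ℝ c (t₁, x₁) (1, 0)) t₁ :=
    (h.differentiableAt_c (hI ht₁) x₁).hasFDerivAt.comp_hasDerivAt t₁
      ((hasDerivAt_id t₁).prodMk (hasDerivAt_const t₁ x₁))
  have hexp : HasDerivAt (fun τ => Real.exp (-K * τ)) (Real.exp (-K * t₁) * -K) t₁ := by
    simpa using! ((hasDerivAt_id t₁).const_mul (-K)).exp
  have hft := hexp.mul hct
  -- Only difference quotients from the left are used, since the minimum may be attained at the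
  -- final time.
  have hle : Real.exp (-K * t₁) * -K * c (t₁, x₁)
      + Real.exp (-K * t₁) * fderiv ℝ c (t₁, x₁) (1, 0) ≤ 0 := by
    refine le_of_tendsto (hft.tendsto_slope.mono_left
      (nhdsWithin_mono t₁ (fun τ (hτ : τ ∈ Iio t₁) => ne_of_lt hτ))) ?_
    filter_upwards [Ioo_mem_nhdsLT ht₁0] with τ hτ
    have hτf : f (t₁, x₁) ≤ f (τ, x₁) :=
      hmin ⟨⟨hτ.1.le, hτ.2.le.trans ht₁.2⟩, mem_closedBall_zero_iff.2 hx₁'.le⟩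
    rw [slope_def_field]
    exact div_nonpos_of_nonneg_of_nonpos (sub_nonneg.2 hτf) (sub_nonpos.2 hτ.2.le)
  have hdiv : |divergence (fun y => u (t₁, y)) x₁| ≤ ‖traceL d‖ * L := by
    rw [divergence_eq]
    refine ((traceL d).le_opNorm _).trans ?_
    gcongr
    exact hL t₁ ht₁ x₁
  rw [h.fderiv_c_apply (hI ht₁), h.eq_c _ (hI ht₁), hspace] at hle
  set D := divergence (fun y => u (t₁, y)) x₁
  have h1 : Real.exp (-K * t₁) * (-c (t₁, x₁) * (K + 1 / n * D)) ≤ 0 := by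
    refine le_trans (le_of_eq ?_) hle
    simp only [zero_apply]
    ring
  have h2 : 0 < K + 1 / n * D := by
    have : -(1 / (n : ℝ) * (‖traceL d‖ * L)) ≤ 1 / n * D := by
      rw [← mul_neg]
      gcongr
      exact (abs_le.1 hdiv).1
    rw [hK]
    linarith
  exact absurd h1 (not_le.2 (mul_pos (Real.exp_pos _) (mul_pos (neg_pos.2 hc1) h2)))

end IsClassicalSolution

/-! ### Transport of integrals -/

/-- Integration by parts against the constant 1. -/
lemma integral_fderiv_eq_zero {f : Sp d → ℝ} (hf : ContDiff ℝ 1 f) (hc : HasCompactSupport f)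
    (v : Sp d) : ∫ x, fderiv ℝ f x v = 0 := by
  have h1 : Continuous fun x => fderiv ℝ f x v :=
    (hf.continuous_fderiv (by simp)).clm_apply continuous_const
  have h2 : HasCompactSupport fun x => fderiv ℝ f x v := hc.fderiv_apply ℝ v
  have := integral_mul_fderiv_eq_neg_fderiv_mul_of_integrable (μ := (volume : Measure (Sp d)))
    (𝕜 := ℝ) (f := fun _ => (1 : ℝ)) (g := f) (v := v)
    (by simp) (by simpa using h1.integrable_of_hasCompactSupport h2)
    (by simpa using hf.continuous.integrable_of_hasCompactSupport hc)
    (fun _ _ => differentiableAt_const _) (fun x _ => hf.differentiable (by simp) x)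
  simpa using this

lemma divergence_eq_sum {v : Sp d → Sp d} {x : Sp d} (hv : DifferentiableAt ℝ v x) :
    divergence v x
      = ∑ i, fderiv ℝ (fun y => v y i) x (EuclideanSpace.basisFun (Fin d) ℝ i) := by
  unfold divergence
  rw [LinearMap.trace_eq_sum_inner _ (EuclideanSpace.basisFun (Fin d) ℝ)]
  refine Finset.sum_congr rfl fun i _ => ?_
  have h2 : HasFDerivAt (fun y => v y i) ((EuclideanSpace.proj (𝕜 := ℝ) i).comp (fderiv ℝ v x)) x :=
    (EuclideanSpace.proj (𝕜 := ℝ) i).hasFDerivAt.comp x hv.hasFDerivAt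
  rw [h2.fderiv]
  simp [EuclideanSpace.inner_single_left]

lemma divergence_eq_zero_of_norm_gt {v : Sp d → Sp d} {R : ℝ} (h0 : ∀ x, R ≤ ‖x‖ → v x = 0)
    {x : Sp d} (hx : R < ‖x‖) : divergence v x = 0 := by
  have : v =ᶠ[𝓝 x] fun _ => 0 := by
    filter_upwards [(isOpen_lt continuous_const continuous_norm).mem_nhds hx] with y hy
    exact h0 y (le_of_lt hy)
  rw [divergence_eq, this.fderiv_eq]
  simp

lemma setIntegral_divergence_eq_zero {v : Sp d → Sp d} {R : ℝ} (hv : ContDiff ℝ 1 v)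
    (h0 : ∀ x, R ≤ ‖x‖ → v x = 0) : ∫ x in Metric.closedBall 0 R, divergence v x = 0 := by
  rw [setIntegral_eq_integral_of_forall_compl_eq_zero fun x hx =>
    divergence_eq_zero_of_norm_gt h0 (by simpa using hx)]
  have hi : ∀ i, ContDiff ℝ 1 fun y => v y i := fun i => contDiff_euclidean.1 hv i
  have hci : ∀ i, HasCompactSupport fun y => v y i := fun i =>
    HasCompactSupport.intro (isCompact_closedBall (0 : Sp d) R) fun x hx => by
      rw [h0 x (le_of_lt (by simpa using hx))]
      rfl
  simp_rw [fun x => divergence_eq_sum (hv.differentiable (by simp) x)]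
  rw [integral_finsetSum]
  · exact Finset.sum_eq_zero fun i _ => integral_fderiv_eq_zero (hi i) (hci i) _
  · intro i _
    exact (((hi i).continuous_fderiv (by simp)).clm_apply
      continuous_const).integrable_of_hasCompactSupport ((hci i).fderiv_apply ℝ _)

lemma divergence_smul {q : Sp d → ℝ} {v : Sp d → Sp d} {x : Sp d} (hq : DifferentiableAt ℝ q x)
    (hv : DifferentiableAt ℝ v x) :
    divergence (fun y => q y • v y) x = fderiv ℝ q x (v x) + q x * divergence v x := by
  have h : HasFDerivAt (fun y => q y • v y)
      (q x • fderiv ℝ v x + (fderiv ℝ q x).smulRight (v x)) x :=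
    hq.hasFDerivAt.smul hv.hasFDerivAt
  rw [divergence_eq, h.fderiv, map_add, map_smul, divergence_eq, add_comm, smul_eq_mul]
  congr 1
  exact LinearMap.trace_smulRight (fderiv ℝ q x : Sp d →ₗ[ℝ] ℝ) (v x)

lemma divergence_id (x : Sp d) : divergence (fun y : Sp d => y) x = d := by
  unfold divergence
  rw [fderiv_fun_id]
  simp

lemma contDiff_slice {E : Type*} [NormedAddCommGroup E] [NormedSpace ℝ E] {I : Set ℝ}
    {f : ℝ × Sp d → E} (hf : ContDiffOn ℝ 1 f (I ×ˢ univ)) {t : ℝ} (ht : t ∈ I) :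
    ContDiff ℝ 1 fun y => f (t, y) :=
  hf.comp_contDiff (by fun_prop) fun y => ⟨ht, mem_univ _⟩

/-- Reynolds' transport theorem, for a quantity that vanishes outside of a ball at time `t`. -/
lemma hasDerivAt_setIntegral {I : Set ℝ} (hI : IsOpen I) {Q : ℝ × Sp d → ℝ}
    {u : ℝ × Sp d → Sp d} (hQ : ContDiffOn ℝ 1 Q (I ×ˢ univ)) (hu : ContDiffOn ℝ 1 u (I ×ˢ univ))
    {t R : ℝ} (ht : t ∈ I) (h0 : ∀ x, R ≤ ‖x‖ → Q (t, x) = 0) :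
    HasDerivAt (fun τ => ∫ x in Metric.closedBall 0 R, Q (τ, x))
      (∫ x in Metric.closedBall 0 R,
        (fderiv ℝ Q (t, x) (1, u (t, x)) + Q (t, x) * divergence (fun y => u (t, y)) x)) t := by
  have hO : IsOpen (I ×ˢ (univ : Set (Sp d))) := hI.prod isOpen_univ
  set B := Metric.closedBall (0 : Sp d) R with hB
  have hBc : IsCompact B := isCompact_closedBall _ _
  have hQd : ∀ τ ∈ I, ∀ x, DifferentiableAt ℝ Q (τ, x) := fun τ hτ x =>
    (hQ.differentiableOn (by simp)).differentiableAt (hO.mem_nhds ⟨hτ, mem_univ _⟩)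
  have hQ' : ContinuousOn (fderiv ℝ Q) (I ×ˢ univ) := hQ.continuousOn_fderiv_of_isOpen hO le_rfl
  have hus : ContDiff ℝ 1 fun y => u (t, y) := contDiff_slice hu ht
  have hQs : ∀ τ ∈ I, ContDiff ℝ 1 fun y => Q (τ, y) := fun τ hτ => contDiff_slice hQ hτ
  have hc0 : ∀ w : Sp d → Sp d, Continuous w → ∀ τ ∈ I,
      Continuous fun x => fderiv ℝ Q (τ, x) (1, w x) := fun w hw τ hτ =>
    (hQ'.comp_continuous (by fun_prop : Continuous fun x : Sp d => (τ, x))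
      fun x => ⟨hτ, mem_univ _⟩).clm_apply (continuous_const.prodMk hw)
  obtain ⟨δ, hδ, hδI⟩ := Metric.nhds_basis_closedBall.mem_iff.1 (hI.mem_nhds ht)
  have hK : IsCompact (Metric.closedBall t δ ×ˢ B) := (isCompact_closedBall _ _).prod hBc
  have hcK : ContinuousOn (fun p => fderiv ℝ Q p ((1 : ℝ), (0 : Sp d)))
      (Metric.closedBall t δ ×ˢ B) :=
    (hQ'.mono (prod_mono hδI (subset_univ _))).clm_apply continuousOn_const
  obtain ⟨C, hC⟩ := hK.exists_bound_of_continuousOn hcK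
  have hder := hasDerivAt_integral_of_dominated_loc_of_deriv_le (𝕜 := ℝ)
    (μ := volume.restrict B) (F := fun τ x => Q (τ, x))
    (F' := fun τ x => fderiv ℝ Q (τ, x) (1, 0)) (bound := fun _ => C) (x₀ := t)
    (Metric.closedBall_mem_nhds t hδ)
    (by
      filter_upwards [hI.mem_nhds ht] with τ hτ
      exact (hQs τ hτ).continuous.aestronglyMeasurable)
    ((hQs t ht).continuous.continuousOn.integrableOn_compact hBc)
    (hc0 (fun _ => 0) continuous_const t ht).aestronglyMeasurable
    (by
      filter_upwards [ae_restrict_mem hBc.measurableSet] with x hx τ hτ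
      exact hC (τ, x) ⟨hτ, hx⟩)
    (continuousOn_const.integrableOn_compact hBc)
    (Eventually.of_forall fun x τ hτ =>
      (hQd τ (hδI hτ) x).hasFDerivAt.comp_hasDerivAt τ
        ((hasDerivAt_id τ).prodMk (hasDerivAt_const τ x)))
  convert! hder.2 using 1
  -- The claimed integrand differs from `∂ₜ Q` by `div (Q u)`, which integrates to zero because `Q`
  -- vanishes at time `t` on the sphere and outside.
  have hdiv := setIntegral_divergence_eq_zero (R := R) (v := fun y => Q (t, y) • u (t, y))
    ((hQs t ht).smul hus) fun x hx => by rw [h0 x hx, zero_smul]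
  rw [← sub_eq_zero, ← integral_sub, ← hdiv]
  · refine integral_congr_ae (Eventually.of_forall fun x => ?_)
    simp only
    rw [divergence_smul ((hQs t ht).differentiable (by simp) x) (hus.differentiable (by simp) x),
      (fderiv_slice (hQd t ht x)).fderiv, fderiv_apply_eq_zero_add]
    ring
  · refine ContinuousOn.integrableOn_compact hBc (Continuous.continuousOn ?_)
    refine (hc0 _ hus.continuous t ht).add ((hQs t ht).continuous.mul ?_)
    exact (traceL d).continuous.comp (hus.continuous_fderiv (by simp))
  · exact (hc0 (fun _ => 0) continuous_const t ht).continuousOn.integrableOn_compact hBc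

/-! ### Conservation laws and the virial identity -/

/-- The pressure, as a function of the sound speed, for the density `a ^ n`. -/
def pressure (n : ℕ) (a : ℝ) : ℝ := n / (n + 2) * a ^ (n + 2)

/-- The energy per unit volume, for the density `a ^ n`. -/
def energyDensity (n : ℕ) (a : ℝ) (v : Sp d) : ℝ :=
  1 / 2 * a ^ n * ‖v‖ ^ 2 + n / 2 * pressure n a

/-- The density of `∫ ρ x · u dx`, for the density `a ^ n`. -/
def virialDensity (n : ℕ) (a : ℝ) (v x : Sp d) : ℝ := a ^ n * inner ℝ x v

lemma contDiff_pressure (n : ℕ) : ContDiff ℝ 1 (pressure n) := by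
  unfold pressure
  fun_prop

lemma hasDerivAt_pressure (n : ℕ) (a : ℝ) : HasDerivAt (pressure n) (n * a ^ (n + 1)) a := by
  unfold pressure
  convert! (hasDerivAt_pow (n + 2) a).const_mul ((n : ℝ) / (n + 2)) using 1
  have : (n : ℝ) + 2 ≠ 0 := by positivity
  push_cast
  field_simp

namespace IsClassicalSolution

variable {n : ℕ} {I : Set ℝ} {c : ℝ × Sp d → ℝ} {u : ℝ × Sp d → Sp d}

/-- Material derivatives in one-variable form, so that the product and power rules yield those of
the mass, energy and virial densities. -/
lemma hasLineDerivAt_c (h : IsClassicalSolution n I c u) {t : ℝ} (ht : t ∈ I) (x : Sp d) :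
    HasDerivAt (fun τ : ℝ => c ((t, x) + τ • ((1 : ℝ), u (t, x))))
      (-(1 / n * c (t, x) * divergence (fun y => u (t, y)) x)) 0 := by
  rw [← h.eq_c t ht x]
  exact (h.differentiableAt_c ht x).hasFDerivAt.hasLineDerivAt _

lemma hasLineDerivAt_u (h : IsClassicalSolution n I c u) {t : ℝ} (ht : t ∈ I) (x : Sp d) :
    HasDerivAt (fun τ : ℝ => u ((t, x) + τ • ((1 : ℝ), u (t, x))))
      (-((n * c (t, x)) • gradient (fun y => c (t, y)) x)) 0 := by
  rw [← h.eq_u t ht x]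
  exact (h.differentiableAt_u ht x).hasFDerivAt.hasLineDerivAt _

lemma fderiv_c_eq_inner (x v : Sp d) (f : Sp d → ℝ) :
    fderiv ℝ f x v = inner ℝ v (gradient f x) := by
  rw [real_inner_comm, gradient, InnerProductSpace.toDual_symm_apply]

lemma contDiffOn_mass (h : IsClassicalSolution n I c u) :
    ContDiffOn ℝ 1 (fun p => c p ^ n) (I ×ˢ univ) := h.contDiffOn_c.pow n

lemma contDiffOn_energy (h : IsClassicalSolution n I c u) :
    ContDiffOn ℝ 1 (fun p => energyDensity n (c p) (u p)) (I ×ˢ univ) :=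
  ((contDiffOn_const.mul h.contDiffOn_mass).mul (h.contDiffOn_u.norm_sq ℝ)).add
    (contDiffOn_const.mul ((contDiff_pressure n).comp_contDiffOn h.contDiffOn_c))

lemma contDiffOn_virial (h : IsClassicalSolution n I c u) :
    ContDiffOn ℝ 1 (fun p => virialDensity n (c p) (u p) p.2) (I ×ˢ univ) :=
  h.contDiffOn_mass.mul (contDiffOn_snd.inner ℝ h.contDiffOn_u)

lemma fderiv_eq_of_hasDerivAt {Q : ℝ × Sp d → ℝ} (hI : IsOpen I)
    (hQ : ContDiffOn ℝ 1 Q (I ×ˢ univ)) {t : ℝ} (ht : t ∈ I) {x : Sp d} {v : ℝ × Sp d} {m : ℝ}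
    (hm : HasDerivAt (fun τ : ℝ => Q ((t, x) + τ • v)) m 0) : fderiv ℝ Q (t, x) v = m := by
  have hd : DifferentiableAt ℝ Q (t, x) := (hQ.differentiableOn (by simp)).differentiableAt
    ((hI.prod isOpen_univ).mem_nhds ⟨ht, mem_univ _⟩)
  exact HasDerivAt.unique (hd.hasFDerivAt.hasLineDerivAt v) hm

lemma mass_balance (h : IsClassicalSolution n I c u) (hn : n ≠ 0) {t : ℝ} (ht : t ∈ I)
    (x : Sp d) :
    fderiv ℝ (fun p => c p ^ n) (t, x) (1, u (t, x))
      + c (t, x) ^ n * divergence (fun y => u (t, y)) x = 0 := by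
  obtain ⟨m, rfl⟩ := Nat.exists_eq_succ_of_ne_zero hn
  have h1 := (h.hasLineDerivAt_c ht x).pow (m + 1)
  rw [fderiv_eq_of_hasDerivAt h.isOpen h.contDiffOn_mass ht h1]
  simp only [zero_smul, add_zero, Nat.add_sub_cancel, Nat.succ_eq_add_one]
  have : ((m + 1 : ℕ) : ℝ) ≠ 0 := by positivity
  field_simp
  ring

/-- The left side is the integrand of the transport theorem. The kinetic part contributes `-u · ∇p`
and the internal part `-p div u`, which add up to a divergence. -/
lemma energy_balance (h : IsClassicalSolution n I c u) (hn : n ≠ 0) {t : ℝ} (ht : t ∈ I)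
    (x : Sp d) :
    fderiv ℝ (fun p => energyDensity n (c p) (u p)) (t, x) (1, u (t, x))
      + energyDensity n (c (t, x)) (u (t, x)) * divergence (fun y => u (t, y)) x
      = -divergence (fun y => pressure n (c (t, y)) • u (t, y)) x := by
  have hc := h.hasLineDerivAt_c ht x
  have hρ := hc.pow n
  have hu := (h.hasLineDerivAt_u ht x).norm_sq
  have hp : HasDerivAt (fun τ : ℝ => pressure n (c ((t, x) + τ • ((1 : ℝ), u (t, x))))) _ 0 :=
    (hasDerivAt_pressure n _).comp 0 hc
  have hm := ((hρ.const_mul (1 / 2)).mul hu).add (hp.const_mul ((n : ℝ) / 2))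
  rw [fderiv_eq_of_hasDerivAt h.isOpen h.contDiffOn_energy ht (hm.congr_of_eventuallyEq
    (Eventually.of_forall fun τ => by simp [energyDensity, mul_assoc]))]
  have hdc : DifferentiableAt ℝ (fun y => c (t, y)) x :=
    (fderiv_slice (h.differentiableAt_c ht x)).differentiableAt
  have hdp : HasFDerivAt (fun y => pressure n (c (t, y)))
      ((n * c (t, x) ^ (n + 1)) • fderiv ℝ (fun y => c (t, y)) x) x :=
    (hasDerivAt_pressure n _).comp_hasFDerivAt x hdc.hasFDerivAt
  rw [divergence_smul hdp.differentiableAt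
    (fderiv_slice (h.differentiableAt_u ht x)).differentiableAt, hdp.fderiv]
  simp only [zero_smul, add_zero, smul_apply, Pi.pow_apply, fderiv_c_eq_inner, inner_neg_right,
    real_inner_smul_right, smul_eq_mul]
  set g := inner ℝ (u (t, x)) (gradient (fun y => c (t, y)) x)
  obtain ⟨m, rfl⟩ := Nat.exists_eq_succ_of_ne_zero hn
  have h1 : ((m : ℝ) + 1) ≠ 0 := by positivity
  have h2 : ((m : ℝ) + 1 + 2) ≠ 0 := by positivity
  unfold energyDensity pressure
  simp only [Nat.add_sub_cancel, Nat.succ_eq_add_one]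
  push_cast
  field_simp
  ring

/-- The pressure force contributes `-x · ∇p = d p - div (p x)`. -/
lemma virial_balance (h : IsClassicalSolution n I c u) (hn : n ≠ 0) {t : ℝ} (ht : t ∈ I)
    (x : Sp d) :
    fderiv ℝ (fun p => virialDensity n (c p) (u p) p.2) (t, x) (1, u (t, x))
      + virialDensity n (c (t, x)) (u (t, x)) x * divergence (fun y => u (t, y)) x
      = c (t, x) ^ n * ‖u (t, x)‖ ^ 2 + d * pressure n (c (t, x))
        - divergence (fun y => pressure n (c (t, y)) • y) x := by
  have hc := h.hasLineDerivAt_c ht x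
  have hρ := hc.pow n
  have hx : HasDerivAt (fun τ : ℝ => ((t, x) + τ • ((1 : ℝ), u (t, x))).2) (u (t, x)) 0 := by
    simpa using! ((hasDerivAt_id (0 : ℝ)).smul_const (u (t, x))).const_add x
  have hm := hρ.mul (hx.inner ℝ (h.hasLineDerivAt_u ht x))
  rw [fderiv_eq_of_hasDerivAt h.isOpen h.contDiffOn_virial ht hm]
  have hdc : DifferentiableAt ℝ (fun y => c (t, y)) x :=
    (fderiv_slice (h.differentiableAt_c ht x)).differentiableAt
  have hdp : HasFDerivAt (fun y => pressure n (c (t, y)))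
      ((n * c (t, x) ^ (n + 1)) • fderiv ℝ (fun y => c (t, y)) x) x :=
    (hasDerivAt_pressure n _).comp_hasFDerivAt x hdc.hasFDerivAt
  rw [divergence_smul hdp.differentiableAt differentiableAt_fun_id, hdp.fderiv, divergence_id]
  simp only [zero_smul, add_zero, smul_apply, Pi.pow_apply, fderiv_c_eq_inner, inner_neg_right,
    real_inner_smul_right, smul_eq_mul, real_inner_self_eq_norm_sq]
  set g := inner ℝ x (gradient (fun y => c (t, y)) x)
  obtain ⟨m, rfl⟩ := Nat.exists_eq_succ_of_ne_zero hn
  have h1 : ((m : ℝ) + 1) ≠ 0 := by positivity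
  unfold virialDensity
  simp only [Nat.add_sub_cancel, Nat.succ_eq_add_one]
  push_cast
  field_simp
  ring

end IsClassicalSolution

/-! ### Finite time of existence -/

lemma pressure_nonneg (n : ℕ) {a : ℝ} (ha : 0 ≤ a) : 0 ≤ pressure n a := by
  unfold pressure
  positivity

lemma energyDensity_nonneg (n : ℕ) {a : ℝ} (ha : 0 ≤ a) (v : Sp d) : 0 ≤ energyDensity n a v :=
  add_nonneg (by positivity) (mul_nonneg (by positivity) (pressure_nonneg n ha))

/-- The kinetic coefficient `1 / (2 n)` is at most 1, and the pressure coefficient `1 / n * (n / 2)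
= 1 / 2` is at most `d`. -/
lemma inv_mul_energyDensity_le {n : ℕ} (hn : n ≠ 0) (hd : 1 ≤ d) {a : ℝ} (ha : 0 ≤ a) (v : Sp d) :
    1 / (n : ℝ) * energyDensity n a v ≤ a ^ n * ‖v‖ ^ 2 + d * pressure n a := by
  have hn1 : (1 : ℝ) ≤ n := by exact_mod_cast Nat.one_le_iff_ne_zero.2 hn
  have hd1 : (1 : ℝ) ≤ d := by exact_mod_cast hd
  have hp := pressure_nonneg n ha
  have hk : 0 ≤ a ^ n * ‖v‖ ^ 2 := by positivity
  have e : 1 / (n : ℝ) * energyDensity n a v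
      = 1 / n * (1 / 2 * (a ^ n * ‖v‖ ^ 2)) + 1 / 2 * pressure n a := by
    unfold energyDensity
    field_simp
  rw [e]
  have h1 : 1 / (n : ℝ) ≤ 1 := by
    rw [div_le_one (by linarith)]
    exact hn1
  have h2 : 1 / (n : ℝ) * (1 / 2 * (a ^ n * ‖v‖ ^ 2)) ≤ 1 * (1 / 2 * (a ^ n * ‖v‖ ^ 2)) :=
    mul_le_mul_of_nonneg_right h1 (by positivity)
  have h3 : 1 * pressure n a ≤ d * pressure n a := mul_le_mul_of_nonneg_right hd1 hp
  linarith

lemma virialDensity_le {n : ℕ} {a R : ℝ} (ha : 0 ≤ a) (v : Sp d) {x : Sp d} (hx : ‖x‖ ≤ R) :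
    virialDensity n a v x ≤ R * (1 / 2 * a ^ n + energyDensity n a v) := by
  have hR : 0 ≤ R := (norm_nonneg x).trans hx
  have han : 0 ≤ a ^ n := by positivity
  have hp : 0 ≤ n / 2 * pressure n a := mul_nonneg (by positivity) (pressure_nonneg n ha)
  have h1 : inner ℝ x v ≤ R * ‖v‖ :=
    (real_inner_le_norm x v).trans (mul_le_mul_of_nonneg_right hx (norm_nonneg v))
  have h2 : ‖v‖ ≤ 1 / 2 + 1 / 2 * ‖v‖ ^ 2 := by nlinarith [sq_nonneg (‖v‖ - 1)]
  calc a ^ n * inner ℝ x v ≤ a ^ n * (R * (1 / 2 + 1 / 2 * ‖v‖ ^ 2)) := by gcongr; nlinarith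
    _ = R * (1 / 2 * a ^ n + 1 / 2 * a ^ n * ‖v‖ ^ 2) := by ring
    _ ≤ R * (1 / 2 * a ^ n + energyDensity n a v) := by
        unfold energyDensity
        gcongr
        linarith

namespace IsClassicalSolution

variable {n : ℕ} {I : Set ℝ} {c : ℝ × Sp d → ℝ} {u : ℝ × Sp d → Sp d}

/-- The virial `∫ ρ x · u dx` grows at a linear rate, and is bounded in terms of the radius of the
support of the gas. -/
lemma virial_bound (h : IsClassicalSolution n I c u) (hn : n ≠ 0) (hd : 1 ≤ d) {T ε R : ℝ}
    (hT : 0 ≤ T) (hI : Icc 0 T ⊆ I) (hε : 0 ≤ ε) (h0 : ∀ x, 0 ≤ c (0, x))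
    (hq : QuietOutside (fun y => c (0, y)) (fun y => u (0, y)) ε R) :
    (∫ x, virialDensity n (c (0, x)) (u (0, x)) x)
        + 1 / n * (∫ x, energyDensity n (c (0, x)) (u (0, x))) * T
      ≤ (R + ε * T) * (1 / 2 * (∫ x, c (0, x) ^ n)
        + ∫ x, energyDensity n (c (0, x)) (u (0, x))) := by
  -- One fixed ball contains the gas at all times up to `T`, so the domain of integration does not
  -- move.
  set R' := R + ε * T with hR'
  set B := Metric.closedBall (0 : Sp d) R' with hB
  have hBc : IsCompact B := isCompact_closedBall _ _
  have hz : ∀ t ∈ Icc 0 T, ∀ x, R' ≤ ‖x‖ → c (t, x) = 0 := fun t ht x hx => by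
    refine (h.quietOutside hI hε hq ht x (le_trans ?_ hx)).1
    have := mul_le_mul_of_nonneg_left ht.2 hε
    linarith
  have hpos : ∀ t ∈ Icc 0 T, ∀ x, 0 ≤ c (t, x) := fun t ht x => h.nonneg hI h0 hz ht x
  have hp0 : pressure n 0 = 0 := by simp [pressure]
  have z1 : ∀ t ∈ Icc 0 T, ∀ x, R' ≤ ‖x‖ → c (t, x) ^ n = 0 := fun t ht x hx => by
    rw [hz t ht x hx, zero_pow hn]
  have z2 : ∀ t ∈ Icc 0 T, ∀ x, R' ≤ ‖x‖ → energyDensity n (c (t, x)) (u (t, x)) = 0 :=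
    fun t ht x hx => by
      rw [energyDensity, z1 t ht x hx, hz t ht x hx, hp0]
      simp
  have z3 : ∀ t ∈ Icc 0 T, ∀ x, R' ≤ ‖x‖ → virialDensity n (c (t, x)) (u (t, x)) x = 0 :=
    fun t ht x hx => by
      rw [virialDensity, z1 t ht x hx, zero_mul]
  have cc : ∀ t ∈ I, ContDiff ℝ 1 fun y => c (t, y) := fun t ht => contDiff_slice h.contDiffOn_c ht
  have cu : ∀ t ∈ I, ContDiff ℝ 1 fun y => u (t, y) := fun t ht => contDiff_slice h.contDiffOn_u ht
  have cp : ∀ t ∈ I, ContDiff ℝ 1 fun y => pressure n (c (t, y)) := fun t ht =>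
    (contDiff_pressure n).comp (cc t ht)
  have i1 : ∀ t ∈ I, IntegrableOn (fun x => c (t, x) ^ n) B := fun t ht =>
    ((cc t ht).continuous.pow n).continuousOn.integrableOn_compact hBc
  have i2 : ∀ t ∈ I, IntegrableOn (fun x => energyDensity n (c (t, x)) (u (t, x))) B :=
    fun t ht => (contDiff_slice h.contDiffOn_energy ht).continuous.continuousOn.integrableOn_compact
      hBc
  have i3 : ∀ t ∈ I, IntegrableOn (fun x => virialDensity n (c (t, x)) (u (t, x)) x) B :=
    fun t ht => (contDiff_slice h.contDiffOn_virial ht).continuous.continuousOn.integrableOn_compact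
      hBc
  have zdiv : ∀ t ∈ Icc 0 T, ∀ v : Sp d → Sp d, ContDiff ℝ 1 v →
      ∫ x in B, divergence (fun y => pressure n (c (t, y)) • v y) x = 0 := fun t ht v hv =>
    setIntegral_divergence_eq_zero ((cp t (hI ht)).smul hv) fun x hx => by
      rw [hz t ht x hx, hp0, zero_smul]
  have m1 : ∀ t ∈ Icc 0 T, HasDerivAt (fun τ => ∫ x in B, c (τ, x) ^ n) 0 t := fun t ht => by
    convert! hasDerivAt_setIntegral h.isOpen h.contDiffOn_mass h.contDiffOn_u (hI ht) (z1 t ht)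
      using 1
    simp only [h.mass_balance hn (hI ht), integral_zero]
  have m2 : ∀ t ∈ Icc 0 T,
      HasDerivAt (fun τ => ∫ x in B, energyDensity n (c (τ, x)) (u (τ, x))) 0 t := fun t ht => by
    convert! hasDerivAt_setIntegral h.isOpen h.contDiffOn_energy h.contDiffOn_u (hI ht) (z2 t ht)
      using 1
    simp only [h.energy_balance hn (hI ht)]
    rw [integral_neg, zdiv t ht _ (cu t (hI ht)), neg_zero]
  have m3 : ∀ t ∈ Icc 0 T,
      HasDerivAt (fun τ => ∫ x in B, virialDensity n (c (τ, x)) (u (τ, x)) x)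
        (∫ x in B, (c (t, x) ^ n * ‖u (t, x)‖ ^ 2 + d * pressure n (c (t, x)))) t := fun t ht => by
    convert! hasDerivAt_setIntegral h.isOpen h.contDiffOn_virial h.contDiffOn_u (hI ht) (z3 t ht)
      using 1
    simp only [h.virial_balance hn (hI ht)]
    rw [integral_sub, zdiv t ht _ contDiff_fun_id, sub_zero]
    · exact (((cc t (hI ht)).continuous.pow n |>.mul ((cu t (hI ht)).continuous.norm.pow 2)).add
        (continuous_const.mul (cp t (hI ht)).continuous)).continuousOn.integrableOn_compact hBc
    · have : Continuous fun x => divergence (fun y => pressure n (c (t, y)) • y) x :=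
        (traceL d).continuous.comp
          (((cp t (hI ht)).smul contDiff_fun_id).continuous_fderiv (by simp))
      exact this.continuousOn.integrableOn_compact hBc
  have const : ∀ f : ℝ → ℝ, (∀ t ∈ Icc 0 T, HasDerivAt f 0 t) → ∀ t ∈ Icc 0 T, f t = f 0 :=
    fun f hf => constant_of_has_deriv_right_zero
      (fun t ht => (hf t ht).continuousAt.continuousWithinAt)
      (fun t ht => (hf t (Ico_subset_Icc_self ht)).hasDerivWithinAt)
  have hM := const _ m1
  have hE := const _ m2
  set M := ∫ x in B, c (0, x) ^ n with hMd
  set E := ∫ x in B, energyDensity n (c (0, x)) (u (0, x)) with hEd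
  have h0T : (0 : ℝ) ∈ Icc 0 T := ⟨le_rfl, hT⟩
  have hTT : T ∈ Icc 0 T := ⟨hT, le_rfl⟩
  have hout : ∀ x ∉ B, R' ≤ ‖x‖ := fun x hx => le_of_lt (by simpa [hB] using hx)
  rw [← setIntegral_eq_integral_of_forall_compl_eq_zero fun x hx => z1 0 h0T x (hout x hx),
    ← setIntegral_eq_integral_of_forall_compl_eq_zero fun x hx => z2 0 h0T x (hout x hx),
    ← setIntegral_eq_integral_of_forall_compl_eq_zero fun x hx => z3 0 h0T x (hout x hx),
    ← hMd, ← hEd]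
  have hgrow : ∀ t ∈ Icc 0 T, 1 / (n : ℝ) * E
      ≤ ∫ x in B, (c (t, x) ^ n * ‖u (t, x)‖ ^ 2 + d * pressure n (c (t, x))) := fun t ht => by
    rw [← hE t ht, ← integral_const_mul]
    refine integral_mono ((i2 t (hI ht)).const_mul _) ?_ fun x =>
      inv_mul_energyDensity_le hn hd (hpos t ht x) _
    exact (((cc t (hI ht)).continuous.pow n |>.mul ((cu t (hI ht)).continuous.norm.pow 2)).add
        (continuous_const.mul (cp t (hI ht)).continuous)).continuousOn.integrableOn_compact hBc
  have hF := Convex.mul_sub_le_image_sub_of_le_deriv (convex_Icc (0 : ℝ) T)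
    (fun t ht => (m3 t ht).continuousAt.continuousWithinAt)
    (fun t ht => (m3 t (interior_subset ht)).differentiableAt.differentiableWithinAt)
    (C := 1 / (n : ℝ) * E)
    (fun t ht => by
      rw [(m3 t (interior_subset ht)).deriv]
      exact hgrow t (interior_subset ht)) 0 h0T T hTT hT
  have hle : ∫ x in B, virialDensity n (c (T, x)) (u (T, x)) x ≤ R' * (1 / 2 * M + E) := by
    rw [← hM T hTT, ← hE T hTT, ← integral_const_mul, ← integral_add ((i1 T (hI hTT)).const_mul _)
      (i2 T (hI hTT)), ← integral_const_mul]
    refine setIntegral_mono_on (i3 T (hI hTT))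
      ((((i1 T (hI hTT)).const_mul _).add (i2 T (hI hTT))).const_mul _) hBc.measurableSet
      fun x hx => virialDensity_le (hpos T hTT x) _ (by simpa [hB] using hx)
  rw [sub_zero] at hF
  linarith

end IsClassicalSolution

lemma exists_quietOutside {s : ℝ} (hs : 1 + (d : ℝ) / 2 < s) {c₀ : Sp d → ℝ} {u₀ : Sp d → Sp d}
    (hu_cont : Continuous u₀) (hu : ∀ i, MemH s (fun x => u₀ x i)) (hc_nonneg : ∀ x, 0 ≤ c₀ x)
    (hb : Bornology.IsBounded (region c₀)) {ε : ℝ} (hε : 0 < ε) :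
    ∃ R, IsClassicalSolution.QuietOutside c₀ u₀ ε R := by
  have hi : ∀ i, Tendsto (fun x => u₀ x i) (cocompact (Sp d)) (𝓝 0) := fun i => by
    obtain ⟨g, hg⟩ := hu i
    exact hg.tendsto_zero (by linarith)
      ((EuclideanSpace.proj (𝕜 := ℝ) i).continuous.comp hu_cont)
  have hn : Tendsto (fun x => ‖u₀ x‖) (cocompact (Sp d)) (𝓝 0) := by
    simp_rw [EuclideanSpace.norm_eq]
    have : Tendsto (fun x => ∑ i, ‖u₀ x i‖ ^ 2) (cocompact (Sp d)) (𝓝 0) := by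
      simpa using tendsto_finsetSum Finset.univ fun i _ => ((hi i).norm.pow 2)
    simpa using this.sqrt
  obtain ⟨R₁, hR₁⟩ := hb.subset_closedBall 0
  have hev : ∀ᶠ x in cocompact (Sp d), ‖u₀ x‖ ≤ ε := hn.eventually_le_const hε
  rw [← Metric.cobounded_eq_cocompact, ← comap_norm_atTop, eventually_comap,
    eventually_atTop] at hev
  obtain ⟨R₂, hR₂⟩ := hev
  -- The `+ 1` excludes the boundary sphere of the closed ball containing the gas.
  refine ⟨max (R₁ + 1) R₂, fun y hy => ⟨?_, hR₂ _ ((le_max_right _ _).trans hy) y rfl⟩⟩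
  by_contra hc
  have hmem : y ∈ region c₀ := lt_of_le_of_ne (hc_nonneg y) (Ne.symm hc)
  have := mem_closedBall_zero_iff.1 (hR₁ hmem)
  linarith [(le_max_left (R₁ + 1) R₂).trans hy]

lemma hasCompactSupport_of_quietOutside {c₀ : Sp d → ℝ} {u₀ : Sp d → Sp d} {ε R : ℝ}
    (h : IsClassicalSolution.QuietOutside c₀ u₀ ε R) : HasCompactSupport c₀ :=
  HasCompactSupport.intro (isCompact_closedBall (0 : Sp d) R) fun x hx =>
    (h x (le_of_lt (by simpa using hx))).1

/-- No solution with compactly supported sound speed exists for all times. Since `u₀ ∈ H^s` tends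
to zero at infinity, for each `ε > 0` the gas stays in a ball of radius `R + ε t`, so that the
virial `∫ ρ x · u dx` is at most `C (R + ε t)`; but it grows at least like `E t / n`, where `E > 0`
is the energy. This needs no condition on `∫ det ∇u₀ dx`. -/
theorem maximalTime_lt_top {γ s : ℝ} (hs : 1 + (d : ℝ) / 2 < s) {n : ℕ} (hn : n ≠ 0) (hd : 1 ≤ d)
    (hκ : kappa γ = 1 / n) {c₀ : Sp d → ℝ} {u₀ : Sp d → Sp d}
    (hc_cont : Continuous c₀) (hu_cont : Continuous u₀) (hu : ∀ i, MemH s (fun x => u₀ x i))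
    (hc_nonneg : ∀ x, 0 ≤ c₀ x) (hne : (region c₀).Nonempty)
    (hb : Bornology.IsBounded (region c₀)) : maximalTime γ s c₀ u₀ < ⊤ := by
  set M := ∫ x, c₀ x ^ n with hM
  set E := ∫ x, energyDensity n (c₀ x) (u₀ x) with hE
  set F := ∫ x, virialDensity n (c₀ x) (u₀ x) x with hF
  have hM0 : 0 ≤ M := integral_nonneg fun x => pow_nonneg (hc_nonneg x) n
  have hE0 : 0 < E := by
    obtain ⟨x, hx⟩ := hne
    obtain ⟨R, hR⟩ := exists_quietOutside hs hu_cont hu hc_nonneg hb one_pos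
    refine Continuous.integral_pos_of_hasCompactSupport_nonneg_nonzero (x := x) ?_ ?_
      (fun y => energyDensity_nonneg n (hc_nonneg y) _) ?_
    · have := (contDiff_pressure n).continuous
      unfold energyDensity
      fun_prop
    · refine (hasCompactSupport_of_quietOutside hR).mono' ?_
      refine Function.support_subset_iff'.2 fun y hy => ?_
      rw [image_eq_zero_of_notMem_tsupport hy]
      simp [energyDensity, pressure, zero_pow hn]
    · have hx' : 0 < c₀ x := hx
      have : 0 < energyDensity n (c₀ x) (u₀ x) := by
        unfold energyDensity pressure
        positivity
      exact this.ne'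
  set S := 1 / 2 * M + E with hS
  have hS0 : 0 < S := by positivity
  have hn0 : (0 : ℝ) < n := by positivity
  -- Then `ε S = E / (2 n)`, half of the guaranteed growth rate `E / n` of the virial.
  set ε := E / (2 * n * S) with hε
  have hε0 : 0 < ε := by positivity
  obtain ⟨R, hR⟩ := exists_quietOutside hs hu_cont hu hc_nonneg hb hε0
  -- Beyond this time, the remaining growth `E t / (2 n)` exceeds `R S - F`. The bound is applied at
  -- `T + 1` to get a strict contradiction.
  set T := max 0 ((R * S - F) * (2 * n) / E) with hT
  have hT0 : 0 ≤ T := le_max_left _ _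
  refine lt_of_le_of_lt (sSup_le ?_) (ENNReal.ofReal_lt_top (r := T + 1))
  rintro _ ⟨a, b, ha, -, rfl, c, u, hsol⟩
  refine ENNReal.ofReal_le_ofReal ?_
  by_contra hlt
  push Not at hlt
  have hcl := hsol.isClassicalSolution hs hn hκ isOpen_Ioo
  have hc0 : c 0 = c₀ := hsol.1
  have hu0 : u 0 = u₀ := hsol.2.1
  have key := hcl.virial_bound hn hd (T := T + 1) (ε := ε) (R := R) (by linarith)
    (fun t ht => ⟨ha.trans_le ht.1, ht.2.trans_lt hlt⟩) hε0.le
    (by simpa [hc0] using hc_nonneg) (by simpa [hc0, hu0] using! hR)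
  simp only [hc0, hu0, ← hM, ← hE, ← hF, ← hS] at key
  have e1 : ε * (T + 1) * S = E / (2 * n) * (T + 1) := by
    rw [hε]
    field_simp
  have e2 : 1 / (n : ℝ) * E * (T + 1) = 2 * (E / (2 * n) * (T + 1)) := by
    field_simp
  have e3 : R * S - F ≤ E / (2 * n) * T := by
    have := le_max_right 0 ((R * S - F) * (2 * n) / E)
    rw [← hT, div_le_iff₀ hE0] at this
    rw [div_mul_eq_mul_div, le_div_iff₀ (by positivity)]
    linarith
  have e4 : 0 < E / (2 * n) := by positivity
  rw [add_mul, e1, e2] at key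
  linarith

end GasVacuum

end

/-! ### The two exponents of the statement -/

theorem mainTheorem5 (d : ℕ) (A γ s : ℝ) (hA : 0 < A)
    (hγ : (2 ≤ d ∧ γ = 1 + 1 / ((d : ℝ) - 1)) ∨ (1 ≤ d ∧ γ = 1 + 2 / (d : ℝ)))
    (hs : 1 + (d : ℝ) / 2 < s)
    (c₀ : GasVacuum.Sp d → ℝ) (u₀ : GasVacuum.Sp d → GasVacuum.Sp d)
    (hc_cont : Continuous c₀) (hu_cont : Continuous u₀)
    (hc : GasVacuum.MemH s c₀) (hu : ∀ i, GasVacuum.MemH s (fun x => u₀ x i))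
    (hc_nonneg : ∀ x, 0 ≤ c₀ x)
    (hΩ_nonempty : (GasVacuum.region c₀).Nonempty)
    (hΩ_bounded : Bornology.IsBounded (GasVacuum.region c₀))
    (hΩ_smooth : GasVacuum.HasSmoothBoundary (GasVacuum.region c₀))
    (hJ : GasVacuum.jacobianIntegral c₀ u₀ <
      (2 * A * GasVacuum.totalMass A γ c₀ ^ γ / ((γ - 1) * GasVacuum.inertia A γ c₀))
        ^ ((d : ℝ) / 2)) :
    GasVacuum.maximalTime γ s c₀ u₀ < ⊤ := by
  rcases hγ with ⟨hd, rfl⟩ | ⟨hd, rfl⟩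
  -- Here `κ = 1 / (2 (d - 1))`; the natural subtraction is exact since `2 ≤ d`.
  · refine GasVacuum.maximalTime_lt_top hs (n := 2 * (d - 1)) (by omega) (by omega) ?_ hc_cont
      hu_cont hu hc_nonneg hΩ_nonempty hΩ_bounded
    have : (d : ℝ) - 1 ≠ 0 := by
      have : (2 : ℝ) ≤ d := by exact_mod_cast hd
      linarith
    rw [GasVacuum.kappa, Nat.cast_mul, Nat.cast_sub (by omega)]
    push_cast
    field_simp
    ring
  -- In the mono-atomic case, `κ = 1 / d`.
  · refine GasVacuum.maximalTime_lt_top hs (n := d) (by omega) hd ?_ hc_cont hu_cont hu hc_nonneg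
      hΩ_nonempty hΩ_bounded
    have : (d : ℝ) ≠ 0 := by positivity
    rw [GasVacuum.kappa]
    field_simp
    ring
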